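/- Let $\mathbb K$ be a field of characteristic $0$, let $A$ be an associative unital (not necessarily commutative) $\mathbb K$-algebra, and put $A^e=A\otimes_{\mathbb K}A^{\mathrm{op}}$; $A$-bimodules are identified with left $A^e$-modules. A (left) $A$-bialgebroid is a $\mathbb K$-algebra $\mathcal B$ with a $\mathbb K$-algebra map $\eta:A^e\to\mathcal B$ (source $s(a)=\eta(a\otimes 1)$, target $t(a^{\mathrm{op}})=\eta(1\otimes a^{\mathrm{op}})$) and an $A$-coring structure $(\Delta,\varepsilon)$ on $\mathcal B$, regarded as a left $A^e$-module through $\eta$ and left multiplication, such that $\Delta$ takes values in the Takeuchi product $\mathcal B\times_A\mathcal B=\{\sum_i m_i\otimes_A n_i\mid \sum_i m_it(a^{\mathrm{op}})\otimes_A n_i=\sum_i m_i\otimes_A n_is(a)\ \forall a\in A\}$ and is a morphism of $\mathbb K$-algebras into it (with componentwise product), $\varepsilon(1)=1$, and $\varepsilon(\xi s(\varepsilon(\xi')))=\varepsilon(\xi\xi')=\varepsilon(\xi t(\varepsilon(\xi')^{\mathrm{op}}))$ for all $\xi,\xi'\in\mathcal B$. A morphism of $A$-bialgebroids is a $\mathbb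 K$-algebra map commuting with the sources, targets, counits and comultiplications. Let $\mathrm{Prim}(\mathcal B)=\{X\in\mathcal B\mid\Delta(X)=X\otimes_A1+1\otimes_AX\}$. The primitive filtration $(F_n(\mathcal B))_{n\ge 0}$ is the image in $\mathcal B$ of the filtration by degree of the tensor $A^e$-ring on the $A^e$-bimodule $A^e\otimes_{\mathbb K}\mathrm{Prim}(\mathcal B)\otimes_{\mathbb K}A^e$; that is, $F_n(\mathcal B)$ is the sum of $\eta(A^e)$ and of the $\mathbb K$-spans of all products of $k$ elements of the form $\eta(x)X\eta(y)$ with $x,y\in A^e$, $X\in\mathrm{Prim}(\mathcal B)$, for $1\le k\le n$. Put $F_{-1}(\mathcal B)=0$ and $\mathrm{gr}_n(\mathcal B)=F_n(\mathcal B)/F_{n-1}(\mathcal B)$. One says that $\mathcal B$ is primitively generated if $\mathcal B=\bigcup_nF_n(\mathcal B)$, and that a primitively generated $\mathcal B$ is graded projective if every $\mathrm{gr}_n(\mathcal B)$ is a projective left $A^e$-module. In that case $\Delta$ is filtered and the canonical map $\mathrm{gr}(\mathcal B)\otimes_A\mathrm{gr}(\mathcal B)\to\mathrm{gr}(\mathcal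 B\otimes_A\mathcal B)$ is an isomorphism, so $\mathrm{gr}(\Delta)$ followed by its inverse makes $\mathrm{gr}(\mathcal B)=\bigoplus_n\mathrm{gr}_n(\mathcal B)$ a graded $A$-coring; it is called strongly graded if for all $h,k\ge0$ the component $$\Delta^{[h,k]}:\mathrm{gr}_{h+k}(\mathcal B)\to\mathrm{gr}_h(\mathcal B)\otimes_A\mathrm{gr}_k(\mathcal B)$$ of its comultiplication is injective. **Theorem.** Let $\phi:\mathcal B\to\mathcal B'$ be a morphism of graded projective primitively generated $A$-bialgebroids. If $\mathrm{gr}(\mathcal B)$ is strongly graded as an $A$-coring and $\phi$ is injective when restricted to the left $A^e$-submodule of $\mathcal B$ generated by $\mathrm{Prim}(\mathcal B)$, then $\phi$ is injective. -/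

import Mathlib

open scoped TensorProduct DirectSum

noncomputable section

namespace Bialgd

set_option linter.unusedSectionVars false

universe u v w w'

/-- The enveloping algebra `Aᵉ = A ⊗ Aᵒᵖ`. An `A`-bimodule (with symmetric `K`-action) is a left
module over it, and this is how bimodules are represented throughout. -/
def Env (K : Type u) (A : Type v) [Field K] [Ring A] [Algebra K A] : Type v :=
  A ⊗[K] Aᵐᵒᵖ

namespace Env

variable (K : Type u) {A : Type v} [Field K] [Ring A] [Algebra K A]

instance : Ring (Env K A) := inferInstanceAs (Ring (A ⊗[K] Aᵐᵒᵖ))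

instance : Algebra K (Env K A) := inferInstanceAs (Algebra K (A ⊗[K] Aᵐᵒᵖ))

/-- The pure tensor `a ⊗ b`. -/
def tmul (a : A) (b : Aᵐᵒᵖ) : Env K A := a ⊗ₜ[K] b

theorem tmul_mul_tmul (a a' : A) (b b' : Aᵐᵒᵖ) :
    tmul K a b * tmul K a' b' = tmul K (a * a') (b * b') :=
  Algebra.TensorProduct.tmul_mul_tmul a a' b b'

theorem tmul_one_one : tmul K (1 : A) 1 = 1 := rfl

theorem add_tmul (a a' : A) (b : Aᵐᵒᵖ) : tmul K (a + a') b = tmul K a b + tmul K a' b :=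
  TensorProduct.add_tmul a a' b

theorem tmul_add (a : A) (b b' : Aᵐᵒᵖ) : tmul K a (b + b') = tmul K a b + tmul K a b' :=
  TensorProduct.tmul_add a b b'

theorem smul_tmul (k : K) (a : A) (b : Aᵐᵒᵖ) : tmul K (k • a) b = k • tmul K a b :=
  (TensorProduct.smul_tmul' k a b).symm

theorem tmul_smul (k : K) (a : A) (b : Aᵐᵒᵖ) : tmul K a (k • b) = k • tmul K a b :=
  TensorProduct.tmul_smul k a b

variable {K}

theorem induction {p : Env K A → Prop} (h0 : p 0) (ht : ∀ a b, p (tmul K a b))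
    (ha : ∀ x y, p x → p y → p (x + y)) (x : Env K A) : p x :=
  TensorProduct.induction_on x h0 ht ha

/-- The algebra map `a ⊗ b ↦ f a * g b` for commuting `f` and `g`. -/
def lift {B : Type*} [Ring B] [Algebra K B] (f : A →ₐ[K] B) (g : Aᵐᵒᵖ →ₐ[K] B)
    (h : ∀ a b, Commute (f a) (g b)) : Env K A →ₐ[K] B :=
  (Algebra.TensorProduct.lift f g h : A ⊗[K] Aᵐᵒᵖ →ₐ[K] B)

@[simp] theorem lift_tmul {B : Type*} [Ring B] [Algebra K B] (f : A →ₐ[K] B) (g : Aᵐᵒᵖ →ₐ[K] B)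
    (h : ∀ a b, Commute (f a) (g b)) (a : A) (b : Aᵐᵒᵖ) :
    lift f g h (tmul K a b) = f a * g b :=
  Algebra.TensorProduct.lift_tmul f g h a b

variable (K A)

/-- The map `a ↦ a ⊗ 1`. -/
def includeLeft : A →ₐ[K] Env K A :=
  (Algebra.TensorProduct.includeLeft : A →ₐ[K] A ⊗[K] Aᵐᵒᵖ)

/-- The map `b ↦ 1 ⊗ b`. -/
def includeRight : Aᵐᵒᵖ →ₐ[K] Env K A :=
  (Algebra.TensorProduct.includeRight : Aᵐᵒᵖ →ₐ[K] A ⊗[K] Aᵐᵒᵖ)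

theorem includeLeft_apply (a : A) : includeLeft K A a = tmul K a 1 := rfl

theorem includeRight_apply (b : Aᵐᵒᵖ) : includeRight K A b = tmul K 1 b := rfl

end Env

section Tensor

variable (K : Type u) (A : Type v) [Field K] [Ring A] [Algebra K A]

/-- The action map of the regular bimodule. -/
def regularHom : Env K A →ₐ[K] Module.End K A :=
  (AlgHom.mulLeftRight K A : A ⊗[K] Aᵐᵒᵖ →ₐ[K] Module.End K A)

/-- The regular bimodule: `(a ⊗ bᵒᵖ) • c = a * c * b`. -/
instance regularBimodule : Module (Env K A) A :=
  Module.compHom A (regularHom K A).toRingHom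

theorem env_smul_def (x : Env K A) (c : A) : x • c = regularHom K A x c := rfl

theorem tmul_smul_regular (a b c : A) :
    Env.tmul K a (MulOpposite.op b) • c = a * c * b :=
  AlgHom.mulLeftRight_apply K A a (MulOpposite.op b) c

instance regularBimodule_isScalarTower : IsScalarTower K (Env K A) A :=
  ⟨fun r x c => by simp only [env_smul_def, map_smul, LinearMap.smul_apply]⟩

section Actions

variable (M : Type*) [AddCommGroup M] [Module K M] [Module (Env K A) M]
  [IsScalarTower K (Env K A) M]

/-- The left action `a · m = (a ⊗ 1) m` of `A` on a bimodule. -/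
def lact (a : A) : M →ₗ[K] M := Algebra.lsmul K K M (Env.tmul K a 1)

/-- The right action `m · a = (1 ⊗ aᵒᵖ) m` of `A` on a bimodule. -/
def ract (a : A) : M →ₗ[K] M := Algebra.lsmul K K M (Env.tmul K 1 (MulOpposite.op a))

variable {M}

theorem lact_apply (a : A) (m : M) : lact K A M a m = Env.tmul K a 1 • m := rfl

theorem ract_apply (a : A) (m : M) :
    ract K A M a m = Env.tmul K 1 (MulOpposite.op a) • m := rfl

theorem lact_ract (a b : A) (m : M) :
    lact K A M a (ract K A M b m) = ract K A M b (lact K A M a m) := by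
  simp only [lact_apply, ract_apply, ← mul_smul, Env.tmul_mul_tmul, one_mul,
    mul_one]

end Actions

variable (M N P : Type*)
  [AddCommGroup M] [Module K M] [Module (Env K A) M] [IsScalarTower K (Env K A) M]
  [AddCommGroup N] [Module K N] [Module (Env K A) N] [IsScalarTower K (Env K A) N]
  [AddCommGroup P] [Module K P] [Module (Env K A) P] [IsScalarTower K (Env K A) P]

/-- The relations `m · a ⊗ n = m ⊗ a · n`. -/
def balancedRel : Submodule K (M ⊗[K] N) :=
  Submodule.span K {z | ∃ (a : A) (m : M) (n : N),
    z = (ract K A M a m) ⊗ₜ[K] n - m ⊗ₜ[K] (lact K A N a n)}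

/-- The tensor product `M ⊗_A N` of two `A`-bimodules over the (noncommutative) algebra `A`. -/
def BTensor : Type _ := (M ⊗[K] N) ⧸ balancedRel K A M N

instance : AddCommGroup (BTensor K A M N) :=
  inferInstanceAs (AddCommGroup ((M ⊗[K] N) ⧸ balancedRel K A M N))

instance : Module K (BTensor K A M N) :=
  inferInstanceAs (Module K ((M ⊗[K] N) ⧸ balancedRel K A M N))

namespace BTensor

/-- The bilinear map `(m, n) ↦ m ⊗_A n`. -/
def mk : M →ₗ[K] N →ₗ[K] BTensor K A M N :=
  (TensorProduct.mk K M N).compr₂ (balancedRel K A M N).mkQ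

variable {M N P}

/-- The pure tensor `m ⊗_A n`. -/
abbrev tmul (m : M) (n : N) : BTensor K A M N := mk K A M N m n

theorem ract_tmul (a : A) (m : M) (n : N) :
    tmul K A (ract K A M a m) n = tmul K A m (lact K A N a n) := by
  refine (Submodule.Quotient.eq _).2 (Submodule.subset_span ⟨a, m, n, rfl⟩)

/-- The universal property of `M ⊗_A N` for balanced `K`-bilinear maps. -/
def lift {Q : Type*} [AddCommGroup Q] [Module K Q] (f : M →ₗ[K] N →ₗ[K] Q)
    (hf : ∀ a m n, f (ract K A M a m) n = f m (lact K A N a n)) : BTensor K A M N →ₗ[K] Q :=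
  (balancedRel K A M N).liftQ (TensorProduct.lift f) (by
    refine Submodule.span_le.2 ?_
    rintro _ ⟨a, m, n, rfl⟩
    simp [hf])

variable {K A}

@[simp] theorem lift_tmul {Q : Type*} [AddCommGroup Q] [Module K Q] (f : M →ₗ[K] N →ₗ[K] Q)
    (hf : ∀ a m n, f (ract K A M a m) n = f m (lact K A N a n)) (m : M) (n : N) :
    lift K A f hf (tmul K A m n) = f m n := by
  change TensorProduct.lift f (m ⊗ₜ[K] n) = f m n
  simp

theorem induction {p : BTensor K A M N → Prop} (h0 : p 0)
    (ht : ∀ m n, p (tmul K A m n)) (ha : ∀ x y, p x → p y → p (x + y)) (z : BTensor K A M N) :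
    p z := by
  obtain ⟨y, rfl⟩ := Submodule.Quotient.mk_surjective _ z
  induction y using TensorProduct.induction_on with
  | zero => exact h0
  | tmul m n => exact ht m n
  | add x y hx hy => exact ha _ _ hx hy

theorem hom_ext {Q : Type*} [AddCommGroup Q] [Module K Q] {f g : BTensor K A M N →ₗ[K] Q}
    (h : ∀ m n, f (tmul K A m n) = g (tmul K A m n)) : f = g := by
  ext z
  induction z using induction with
  | h0 => simp
  | ht m n => exact h m n
  | ha x y hx hy => rw [map_add, map_add, hx, hy]

/-- `f ⊗_A g` for `f` commuting with the right action and `g` commuting with the left action. -/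
def mapAux {M' N' : Type*}
    [AddCommGroup M'] [Module K M'] [Module (Env K A) M'] [IsScalarTower K (Env K A) M']
    [AddCommGroup N'] [Module K N'] [Module (Env K A) N'] [IsScalarTower K (Env K A) N']
    (f : M →ₗ[K] M') (g : N →ₗ[K] N')
    (hf : ∀ a m, f (ract K A M a m) = ract K A M' a (f m))
    (hg : ∀ a n, g (lact K A N a n) = lact K A N' a (g n)) :
    BTensor K A M N →ₗ[K] BTensor K A M' N' :=
  lift K A ((mk K A M' N').compl₁₂ f g) (fun a m n => by
    simp only [LinearMap.compl₁₂_apply, hf, hg]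
    exact ract_tmul K A a (f m) (g n))

@[simp] theorem mapAux_tmul {M' N' : Type*}
    [AddCommGroup M'] [Module K M'] [Module (Env K A) M'] [IsScalarTower K (Env K A) M']
    [AddCommGroup N'] [Module K N'] [Module (Env K A) N'] [IsScalarTower K (Env K A) N']
    (f : M →ₗ[K] M') (g : N →ₗ[K] N')
    (hf : ∀ a m, f (ract K A M a m) = ract K A M' a (f m))
    (hg : ∀ a n, g (lact K A N a n) = lact K A N' a (g n)) (m : M) (n : N) :
    mapAux f g hf hg (tmul K A m n) = tmul K A (f m) (g n) := by
  simp [mapAux]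

variable (K A M N)

/-- `A` acting on the left tensor factor from the left. -/
def leftHom : A →ₐ[K] Module.End K (BTensor K A M N) :=
  AlgHom.ofLinearMap
    { toFun := fun a => mapAux (lact K A M a) LinearMap.id (fun b m => lact_ract K A a b m)
        (fun _ _ => rfl)
      map_add' := fun a b => hom_ext fun m n => by
        simp [tmul, lact_apply, Env.add_tmul, add_smul]
      map_smul' := fun r a => hom_ext fun m n => by
        simp [tmul, lact_apply, Env.smul_tmul] }
    (hom_ext fun m n => by
      simp [lact_apply, Env.tmul_one_one])
    (fun a b => hom_ext fun m n => by
      simp [lact_apply, ← mul_smul, Env.tmul_mul_tmul])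

/-- `A` acting on the right tensor factor from the right. -/
def rightHom : Aᵐᵒᵖ →ₐ[K] Module.End K (BTensor K A M N) :=
  AlgHom.ofLinearMap
    { toFun := fun a => mapAux LinearMap.id (ract K A N a.unop) (fun _ _ => rfl)
        (fun b m => (lact_ract K A b a.unop m).symm)
      map_add' := fun a b => hom_ext fun m n => by
        simp [ract_apply, Env.tmul_add, add_smul]
      map_smul' := fun r a => hom_ext fun m n => by
        simp [ract_apply, Env.tmul_smul] }
    (hom_ext fun m n => by
      simp [ract_apply, Env.tmul_one_one])
    (fun a b => hom_ext fun m n => by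
      simp [ract_apply, ← mul_smul, Env.tmul_mul_tmul])

/-- The bimodule structure of `M ⊗_A N` as an algebra map, determined by
`(a ⊗ bᵒᵖ) (m ⊗_A n) = (a · m) ⊗_A (n · b)`. -/
def envHom : Env K A →ₐ[K] Module.End K (BTensor K A M N) :=
  Env.lift (leftHom K A M N) (rightHom K A M N) (fun a b =>
    hom_ext fun m n => by simp [leftHom, rightHom])

instance : Module (Env K A) (BTensor K A M N) :=
  Module.compHom (BTensor K A M N) (envHom K A M N).toRingHom

theorem env_smul_def (x : Env K A) (z : BTensor K A M N) : x • z = envHom K A M N x z := rfl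

instance : IsScalarTower K (Env K A) (BTensor K A M N) :=
  ⟨fun r x c => by simp only [env_smul_def, map_smul, LinearMap.smul_apply]⟩

variable {K A M N}

theorem env_smul_tmul (a b : A) (m : M) (n : N) :
    Env.tmul K a (MulOpposite.op b) • tmul K A m n =
      tmul K A (lact K A M a m) (ract K A N b n) := by
  rw [env_smul_def]
  simp [envHom, leftHom, rightHom]

theorem lact_tmul (a : A) (m : M) (n : N) :
    lact K A _ a (tmul K A m n) = tmul K A (lact K A M a m) n := by
  have h := env_smul_tmul (K := K) a (1 : A) m n
  rw [MulOpposite.op_one] at h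
  rw [lact_apply, h, ract_apply, MulOpposite.op_one, Env.tmul_one_one, one_smul]

theorem ract_tmul_right (a : A) (m : M) (n : N) :
    ract K A _ a (tmul K A m n) = tmul K A m (ract K A N a n) := by
  rw [ract_apply, env_smul_tmul, lact_apply, Env.tmul_one_one, one_smul]

theorem restrict_lact {M' : Type*}
    [AddCommGroup M'] [Module K M'] [Module (Env K A) M'] [IsScalarTower K (Env K A) M']
    (f : M →ₗ[Env K A] M') (a : A) (m : M) :
    f.restrictScalars K (lact K A M a m) = lact K A M' a (f.restrictScalars K m) :=
  map_smul f _ m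

theorem restrict_ract {M' : Type*}
    [AddCommGroup M'] [Module K M'] [Module (Env K A) M'] [IsScalarTower K (Env K A) M']
    (f : M →ₗ[Env K A] M') (a : A) (m : M) :
    f.restrictScalars K (ract K A M a m) = ract K A M' a (f.restrictScalars K m) :=
  map_smul f _ m

/-- `f ⊗_A g` for bimodule maps `f` and `g`. -/
def map {M' N' : Type*}
    [AddCommGroup M'] [Module K M'] [Module (Env K A) M'] [IsScalarTower K (Env K A) M']
    [AddCommGroup N'] [Module K N'] [Module (Env K A) N'] [IsScalarTower K (Env K A) N']
    (f : M →ₗ[Env K A] M') (g : N →ₗ[Env K A] N') :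
    BTensor K A M N →ₗ[Env K A] BTensor K A M' N' where
  toFun := mapAux (f.restrictScalars K) (g.restrictScalars K) (restrict_ract f) (restrict_lact g)
  map_add' := map_add _
  map_smul' x z := by
    rw [RingHom.id_apply]
    induction z using induction with
    | h0 => rw [smul_zero, map_zero, smul_zero]
    | ht m n =>
      induction x using Env.induction with
      | h0 => simp
      | ht a b =>
        rw [← MulOpposite.op_unop b, env_smul_tmul, mapAux_tmul, mapAux_tmul, env_smul_tmul,
          restrict_lact, restrict_ract]
      | ha x y hx hy => simp only [add_smul, map_add, hx, hy]
    | ha x y hx hy => simp only [smul_add, map_add, hx, hy]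

@[simp] theorem map_tmul {M' N' : Type*}
    [AddCommGroup M'] [Module K M'] [Module (Env K A) M'] [IsScalarTower K (Env K A) M']
    [AddCommGroup N'] [Module K N'] [Module (Env K A) N'] [IsScalarTower K (Env K A) N']
    (f : M →ₗ[Env K A] M') (g : N →ₗ[Env K A] N') (m : M) (n : N) :
    map f g (tmul K A m n) = tmul K A (f m) (g n) :=
  mapAux_tmul (f.restrictScalars K) (g.restrictScalars K) (restrict_ract f) (restrict_lact g) m n

variable (K A M N P)

/-- The trilinear map `(m, n, p) ↦ m ⊗_A (n ⊗_A p)`. -/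
def mk₃ : M →ₗ[K] N →ₗ[K] P →ₗ[K] BTensor K A M (BTensor K A N P) where
  toFun m := (mk K A N P).compr₂ (mk K A M (BTensor K A N P) m)
  map_add' x y := by ext n p; simp
  map_smul' r x := by ext n p; simp

@[simp] theorem mk₃_apply (m : M) (n : N) (p : P) :
    mk₃ K A M N P m n p = tmul K A m (tmul K A n p) := rfl

/-- The associativity constraint `(m ⊗_A n) ⊗_A p ↦ m ⊗_A (n ⊗_A p)`. -/
def assoc : BTensor K A (BTensor K A M N) P →ₗ[K] BTensor K A M (BTensor K A N P) :=
  lift K A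
    (lift K A (mk₃ K A M N P) (fun a m n => by
      ext p
      rw [mk₃_apply, mk₃_apply, ract_tmul, lact_tmul]))
    (fun a z p => by
      induction z using induction with
      | h0 => simp
      | ht m n => rw [ract_tmul_right, lift_tmul, lift_tmul, mk₃_apply, mk₃_apply, ract_tmul]
      | ha x y hx hy => simp only [map_add, LinearMap.add_apply, hx, hy])

@[simp] theorem assoc_tmul (m : M) (n : N) (p : P) :
    assoc K A M N P (tmul K A (tmul K A m n) p) = tmul K A m (tmul K A n p) := by
  simp [assoc]

/-- The left unit constraint `a ⊗_A m ↦ a · m`. -/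
def lUnit : BTensor K A A M →ₗ[K] M :=
  lift K A
    { toFun := fun a => lact K A M a
      map_add' := fun a b => by ext m; simp [lact_apply, Env.add_tmul, add_smul]
      map_smul' := fun r a => by ext m; simp [lact_apply, Env.smul_tmul] }
    (fun a b m => by simp [lact_apply, ract_apply, tmul_smul_regular, ← mul_smul, Env.tmul_mul_tmul])

@[simp] theorem lUnit_tmul (a : A) (m : M) : lUnit K A M (tmul K A a m) = lact K A M a m := by
  simp [lUnit]

/-- The right unit constraint `m ⊗_A a ↦ m · a`. -/
def rUnit : BTensor K A M A →ₗ[K] M :=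
  lift K A
    (LinearMap.flip
      { toFun := fun a => ract K A M a
        map_add' := fun a b => by ext m; simp [ract_apply, Env.tmul_add, add_smul]
        map_smul' := fun r a => by ext m; simp [ract_apply, Env.tmul_smul] })
    (fun a m b => by
      have h : lact K A A a b = a * b := by
        have := tmul_smul_regular K A a 1 b
        rwa [MulOpposite.op_one, mul_one] at this
      simp only [LinearMap.flip_apply, LinearMap.coe_mk, AddHom.coe_mk, h]
      simp [ract_apply, ← mul_smul, Env.tmul_mul_tmul])

@[simp] theorem rUnit_tmul (m : M) (a : A) : rUnit K A M (tmul K A m a) = ract K A M a m := by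
  simp [rUnit]

end BTensor

/-- An `A`-coring structure on an `A`-bimodule `C`. -/
structure Coring (C : Type*) [AddCommGroup C] [Module K C] [Module (Env K A) C]
    [IsScalarTower K (Env K A) C] where
  /-- The comultiplication. -/
  comul : C →ₗ[Env K A] BTensor K A C C
  /-- The counit. -/
  counit : C →ₗ[Env K A] A
  coassoc : ∀ c, BTensor.assoc K A C C C (BTensor.map comul LinearMap.id (comul c)) =
    BTensor.map LinearMap.id comul (comul c)
  counit_left : ∀ c, BTensor.lUnit K A C (BTensor.map counit LinearMap.id (comul c)) = c
  counit_right : ∀ c, BTensor.rUnit K A C (BTensor.map LinearMap.id counit (comul c)) = c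

section Filtration

variable {K A M N P}
variable (F : ℕ → Submodule (Env K A) M) (G : ℕ → Submodule (Env K A) N)

/-- `F_{n-1}`, with the convention `F_{-1} = 0`. -/
def prev : ℕ → Submodule (Env K A) M
  | 0 => ⊥
  | n + 1 => F n

/-- The component `gr_n = F_n / F_{n-1}` of the associated graded bimodule. -/
def Gr (n : ℕ) : Type _ := (F n) ⧸ ((prev F n).submoduleOf (F n))

namespace Gr

instance (n : ℕ) : AddCommGroup (Gr F n) :=
  inferInstanceAs (AddCommGroup ((F n) ⧸ ((prev F n).submoduleOf (F n))))

instance (n : ℕ) : Module (Env K A) (Gr F n) :=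
  inferInstanceAs (Module (Env K A) ((F n) ⧸ ((prev F n).submoduleOf (F n))))

instance (n : ℕ) : Module K (Gr F n) :=
  inferInstanceAs (Module K ((F n) ⧸ ((prev F n).submoduleOf (F n))))

instance (n : ℕ) : IsScalarTower K (Env K A) (Gr F n) :=
  inferInstanceAs (IsScalarTower K (Env K A) ((F n) ⧸ ((prev F n).submoduleOf (F n))))

/-- The class in `gr_n` of an element of `F_n`. -/
def mk (n : ℕ) : F n →ₗ[Env K A] Gr F n := ((prev F n).submoduleOf (F n)).mkQ

variable {F} {n : ℕ}

theorem mk_surjective : Function.Surjective (mk F n) := Submodule.mkQ_surjective _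

theorem mk_eq_zero {x : F n} : mk F n x = 0 ↔ (x : M) ∈ prev F n :=
  Submodule.Quotient.mk_eq_zero ((prev F n).submoduleOf (F n))

theorem mk_smul (k : K) (x : F n) : mk F n (k • x) = k • mk F n x := rfl

variable (F) in
/-- A `K`-linear map on `F_n` that vanishes on `F_{n-1}` factors through `gr_n`. -/
def lift {Q : Type*} [AddCommGroup Q] [Module K Q] (f : F n →ₗ[K] Q)
    (hf : ∀ x : F n, (x : M) ∈ prev F n → f x = 0) : Gr F n →ₗ[K] Q :=
  ((((prev F n).submoduleOf (F n)).restrictScalars K).liftQ f (fun x hx => hf x hx)).comp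
    (Submodule.Quotient.restrictScalarsEquiv K ((prev F n).submoduleOf (F n))).symm.toLinearMap

@[simp] theorem lift_mk {Q : Type*} [AddCommGroup Q] [Module K Q] (f : F n →ₗ[K] Q)
    (hf : ∀ x : F n, (x : M) ∈ prev F n → f x = 0) (x : F n) :
    lift F f hf (mk F n x) = f x := rfl

theorem hom_ext {Q : Type*} [AddCommGroup Q] [Module K Q] {f g : Gr F n →ₗ[K] Q}
    (h : ∀ x, f (mk F n x) = g (mk F n x)) : f = g := by
  ext z
  obtain ⟨x, rfl⟩ := mk_surjective z
  exact h x

end Gr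

/-- The tensor product filtration: `F_n(M ⊗_A N)` is the subbimodule generated by the `m ⊗_A n`
with `m ∈ F_i(M)`, `n ∈ F_j(N)` and `i + j = n`. -/
def tensorFil (n : ℕ) : Submodule (Env K A) (BTensor K A M N) :=
  Submodule.span (Env K A) {z | ∃ i j, i + j = n ∧ ∃ x ∈ F i, ∃ y ∈ G j, z = BTensor.tmul K A x y}

theorem tmul_mem_tensorFil {n i j : ℕ} (h : i + j = n) {x : M} (hx : x ∈ F i) {y : N}
    (hy : y ∈ G j) : BTensor.tmul K A x y ∈ tensorFil F G n :=
  Submodule.subset_span ⟨i, j, h, x, hx, y, hy, rfl⟩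

theorem tmul_mem_prev_left {n i j : ℕ} (h : i + j = n) {x : M} (hx : x ∈ prev F i) {y : N}
    (hy : y ∈ G j) : BTensor.tmul K A x y ∈ prev (tensorFil F G) n := by
  subst h
  cases i with
  | zero =>
    have : x = 0 := hx
    subst this
    simp [BTensor.tmul]
  | succ i =>
    rw [Nat.add_right_comm]
    exact tmul_mem_tensorFil F G rfl hx hy

theorem tmul_mem_prev_right {n i j : ℕ} (h : i + j = n) {x : M} (hx : x ∈ F i) {y : N}
    (hy : y ∈ prev G j) : BTensor.tmul K A x y ∈ prev (tensorFil F G) n := by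
  subst h
  cases j with
  | zero =>
    have : y = 0 := hy
    subst this
    simp
  | succ j => exact tmul_mem_tensorFil F G rfl hx hy

/-- The bilinear map `F_i(M) × F_j(N) → gr_n(M ⊗_A N)`, `(x, y) ↦ [x ⊗_A y]`, for `i + j = n`. -/
def grPre {n i j : ℕ} (h : i + j = n) : F i →ₗ[K] G j →ₗ[K] Gr (tensorFil F G) n :=
  LinearMap.mk₂ K
    (fun x y => Gr.mk (tensorFil F G) n ⟨BTensor.tmul K A (x : M) (y : N),
      tmul_mem_tensorFil F G h x.2 y.2⟩)
    (fun x x' y => by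
      rw [← map_add]
      refine congrArg _ (Subtype.ext ?_)
      exact LinearMap.congr_fun (map_add (BTensor.mk K A M N) (x : M) x') (y : N))
    (fun k x y => by
      rw [← Gr.mk_smul]
      refine congrArg _ (Subtype.ext ?_)
      exact LinearMap.congr_fun (map_smul (BTensor.mk K A M N) k (x : M)) (y : N))
    (fun x y y' => by
      rw [← map_add]
      refine congrArg _ (Subtype.ext ?_)
      exact map_add (BTensor.mk K A M N x) (y : N) y')
    (fun k x y => by
      rw [← Gr.mk_smul]
      refine congrArg _ (Subtype.ext ?_)
      exact map_smul (BTensor.mk K A M N x) k (y : N))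

theorem grPre_apply {n i j : ℕ} (h : i + j = n) (x : F i) (y : G j) :
    grPre F G h x y = Gr.mk (tensorFil F G) n ⟨BTensor.tmul K A (x : M) (y : N),
      tmul_mem_tensorFil F G h x.2 y.2⟩ := rfl

theorem grPre_eq_zero {n i j : ℕ} (h : i + j = n) (x : F i) (y : G j)
    (hy : (y : N) ∈ prev G j) : grPre F G h x y = 0 :=
  Gr.mk_eq_zero.2 (tmul_mem_prev_right F G h x.2 hy)

/-- The bilinear map `F_i(M) × gr_j(N) → gr_n(M ⊗_A N)`, `(x, [y]) ↦ [x ⊗_A y]`. -/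
def grPre' {n i j : ℕ} (h : i + j = n) : F i →ₗ[K] Gr G j →ₗ[K] Gr (tensorFil F G) n where
  toFun x := Gr.lift G (grPre F G h x) (grPre_eq_zero F G h x)
  map_add' x x' := Gr.hom_ext fun y => by
    rw [LinearMap.add_apply, Gr.lift_mk, Gr.lift_mk, Gr.lift_mk, map_add, LinearMap.add_apply]
  map_smul' k x := Gr.hom_ext fun y => by
    rw [LinearMap.smul_apply, Gr.lift_mk, Gr.lift_mk, map_smul, LinearMap.smul_apply,
      RingHom.id_apply]

theorem grPre'_mk {n i j : ℕ} (h : i + j = n) (x : F i) (y : G j) :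
    grPre' F G h x (Gr.mk G j y) = grPre F G h x y := rfl

/-- The bilinear map `gr_i(M) × gr_j(N) → gr_n(M ⊗_A N)`, `([x], [y]) ↦ [x ⊗_A y]`. -/
def grPair {n i j : ℕ} (h : i + j = n) : Gr F i →ₗ[K] Gr G j →ₗ[K] Gr (tensorFil F G) n :=
  Gr.lift F (grPre' F G h) (fun x hx => Gr.hom_ext fun y => by
    rw [grPre'_mk, LinearMap.zero_apply, grPre_apply]
    exact Gr.mk_eq_zero.2 (tmul_mem_prev_left F G h hx y.2))

theorem grPair_mk {n i j : ℕ} (h : i + j = n) (x : F i) (y : G j) :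
    grPair F G h (Gr.mk F i x) (Gr.mk G j y) =
      Gr.mk (tensorFil F G) n ⟨BTensor.tmul K A (x : M) (y : N),
        tmul_mem_tensorFil F G h x.2 y.2⟩ := rfl

/-- The component `gr_i(M) ⊗_A gr_j(N) → gr_n(M ⊗_A N)`, `[x] ⊗_A [y] ↦ [x ⊗_A y]`, of the
canonical map, for `i + j = n`. -/
def grTensorComp {n i j : ℕ} (h : i + j = n) :
    BTensor K A (Gr F i) (Gr G j) →ₗ[K] Gr (tensorFil F G) n :=
  BTensor.lift K A (grPair F G h) (fun a x y => by
    obtain ⟨x, rfl⟩ := Gr.mk_surjective x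
    obtain ⟨y, rfl⟩ := Gr.mk_surjective y
    rw [ract_apply, lact_apply, ← map_smul, ← map_smul, grPair_mk, grPair_mk]
    refine congrArg _ (Subtype.ext ?_)
    exact BTensor.ract_tmul K A a (x : M) (y : N))

theorem grTensorComp_tmul {n i j : ℕ} (h : i + j = n) (x : F i) (y : G j) :
    grTensorComp F G h (BTensor.tmul K A (Gr.mk F i x) (Gr.mk G j y)) =
      Gr.mk (tensorFil F G) n ⟨BTensor.tmul K A (x : M) (y : N),
        tmul_mem_tensorFil F G h x.2 y.2⟩ := by
  rw [grTensorComp, BTensor.lift_tmul, grPair_mk]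

/-- The degree `n` component `⨁_{i+j=n} gr_i(M) ⊗_A gr_j(N) → gr_n(M ⊗_A N)` of the canonical
map `gr(M) ⊗_A gr(N) → gr(M ⊗_A N)`. -/
def grTensor (n : ℕ) :
    (⨁ p : Finset.HasAntidiagonal.antidiagonal n, BTensor K A (Gr F p.1.1) (Gr G p.1.2)) →ₗ[K]
      Gr (tensorFil F G) n :=
  DirectSum.toModule K _ _
    (fun p => grTensorComp F G (Finset.HasAntidiagonal.mem_antidiagonal.1 p.2))

theorem grTensor_of (n : ℕ) (p : Finset.HasAntidiagonal.antidiagonal n)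
    (z : BTensor K A (Gr F p.1.1) (Gr G p.1.2)) :
    grTensor F G n (DirectSum.lof K _ _ p z) =
      grTensorComp F G (Finset.HasAntidiagonal.mem_antidiagonal.1 p.2) z := by
  rw [grTensor, DirectSum.toModule_lof]

/-- As a `K`-subspace, `F_n(M ⊗_A N)` is spanned by pure tensors. -/
theorem mem_span_of_mem_tensorFil {n : ℕ} {z : BTensor K A M N} (hz : z ∈ tensorFil F G n) :
    z ∈ Submodule.span K {z | ∃ i j, i + j = n ∧ ∃ x ∈ F i, ∃ y ∈ G j,
      z = BTensor.tmul K A x y} := by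
  induction hz using Submodule.span_induction with
  | mem z hz => exact Submodule.subset_span hz
  | zero => exact zero_mem _
  | add x y _ _ hx hy => exact add_mem hx hy
  | smul e z _ hz =>
    clear * - hz
    induction hz using Submodule.span_induction with
    | mem z hz =>
      obtain ⟨i, j, hij, x, hx, y, hy, rfl⟩ := hz
      induction e using Env.induction with
      | h0 => rw [zero_smul]; exact zero_mem _
      | ht a b =>
        rw [← MulOpposite.op_unop b, BTensor.env_smul_tmul]
        exact Submodule.subset_span
          ⟨i, j, hij, _, (F i).smul_mem _ hx, _, (G j).smul_mem _ hy, rfl⟩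
      | ha e f he hf => rw [add_smul]; exact add_mem he hf
    | zero => rw [smul_zero]; exact zero_mem _
    | add x y _ _ hx hy => rw [smul_add]; exact add_mem hx hy
    | smul k z _ hz => rw [smul_comm]; exact Submodule.smul_mem _ k hz

theorem grTensor_surjective (n : ℕ) : Function.Surjective (grTensor F G n) := by
  suffices h : ∀ z (hz : z ∈ tensorFil F G n),
      Gr.mk (tensorFil F G) n ⟨z, hz⟩ ∈ LinearMap.range (grTensor F G n) by
    intro z
    obtain ⟨⟨z, hz⟩, rfl⟩ := Gr.mk_surjective z
    exact h z hz
  intro z hz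
  have hz' := mem_span_of_mem_tensorFil F G hz
  suffices h : ∃ hz : z ∈ tensorFil F G n,
      Gr.mk (tensorFil F G) n ⟨z, hz⟩ ∈ LinearMap.range (grTensor F G n) from h.2
  clear hz
  induction hz' using Submodule.span_induction with
  | mem z hz =>
    obtain ⟨i, j, hij, x, hx, y, hy, rfl⟩ := hz
    refine ⟨tmul_mem_tensorFil F G hij hx hy, DirectSum.lof K _ _
      ⟨(i, j), Finset.HasAntidiagonal.mem_antidiagonal.2 hij⟩
      (BTensor.tmul K A (Gr.mk F i ⟨x, hx⟩) (Gr.mk G j ⟨y, hy⟩)), ?_⟩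
    rw [grTensor_of]
    exact grTensorComp_tmul F G hij ⟨x, hx⟩ ⟨y, hy⟩
  | zero => exact ⟨zero_mem _, 0, by rw [map_zero]; exact (map_zero (Gr.mk _ n)).symm⟩
  | add x y _ _ hx hy =>
    obtain ⟨hx, hx'⟩ := hx
    obtain ⟨hy, hy'⟩ := hy
    exact ⟨add_mem hx hy, add_mem hx' hy'⟩
  | smul k z _ hz =>
    obtain ⟨hz, hz'⟩ := hz
    exact ⟨((tensorFil F G n).restrictScalars K).smul_mem k hz, Submodule.smul_mem _ k hz'⟩

section Retraction

variable {F}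

theorem exists_retraction (n : ℕ) [Module.Projective (Env K A) (Gr F (n + 1))] :
    ∃ r : F (n + 1) →ₗ[Env K A] F n, ∀ x : F (n + 1), ∀ hx : (x : M) ∈ F n, r x = ⟨x, hx⟩ := by
  obtain ⟨s, hs⟩ := Module.projective_lifting_property (Gr.mk F (n + 1)) LinearMap.id
    Gr.mk_surjective
  have hmem : ∀ x : F (n + 1), ((x - s (Gr.mk F (n + 1) x) : F (n + 1)) : M) ∈ F n := by
    intro x
    change _ ∈ prev F (n + 1)
    rw [← Gr.mk_eq_zero, map_sub, sub_eq_zero]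
    exact (LinearMap.congr_fun hs _).symm
  refine ⟨LinearMap.codRestrict (F n)
    ((F (n + 1)).subtype ∘ₗ (LinearMap.id - s ∘ₗ Gr.mk F (n + 1))) hmem, fun x hx => ?_⟩
  have h0 : Gr.mk F (n + 1) x = 0 := Gr.mk_eq_zero.2 hx
  refine Subtype.ext ?_
  change ((x - s (Gr.mk F (n + 1) x) : F (n + 1)) : M) = x
  rw [h0, map_zero, sub_zero]

theorem exists_extension (hF : Monotone F) (hproj : ∀ n, Module.Projective (Env K A) (Gr F n))
    (hex : ∀ m, ∃ n, m ∈ F n) (h : ℕ) :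
    ∃ r : M →ₗ[Env K A] Gr F h, ∀ x : F h, r x = Gr.mk F h x := by
  choose ρ hρ using fun n => exists_retraction (F := F) n
  let e : ∀ k, F (h + k) →ₗ[Env K A] Gr F h := fun k =>
    Nat.rec (motive := fun k => F (h + k) →ₗ[Env K A] Gr F h) (Gr.mk F h)
      (fun k f => f ∘ₗ ρ (h + k)) k
  have he : ∀ k d (x : M) (hx : x ∈ F (h + k)) (hx' : x ∈ F (h + (k + d))),
      e (k + d) ⟨x, hx'⟩ = e k ⟨x, hx⟩ := by
    intro k d x hx
    induction d with
    | zero => intro _; rfl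
    | succ d ih =>
      intro hx'
      have h1 : x ∈ F (h + (k + d)) := hF (by omega) hx
      rw [← ih h1]
      change e (k + d) (ρ (h + (k + d)) ⟨x, hx'⟩) = _
      exact congrArg (e (k + d)) (hρ _ ⟨x, hx'⟩ h1)
  have he' : ∀ k l (x : M) (hx : x ∈ F (h + k)) (hx' : x ∈ F (h + l)),
      e k ⟨x, hx⟩ = e l ⟨x, hx'⟩ := by
    intro k l x hx hx'
    rcases le_total k l with hkl | hkl
    · obtain ⟨d, rfl⟩ := Nat.exists_eq_add_of_le hkl
      exact (he k d x hx hx').symm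
    · obtain ⟨d, rfl⟩ := Nat.exists_eq_add_of_le hkl
      exact he l d x hx' hx
  have hex' : ∀ m, ∃ k, m ∈ F (h + k) := fun m =>
    let ⟨n, hn⟩ := hex m
    ⟨n, hF (by omega) hn⟩
  choose N hN using hex'
  refine ⟨{ toFun := fun m => e (N m) ⟨m, hN m⟩, map_add' := ?_, map_smul' := ?_ }, fun x => ?_⟩
  · intro x y
    have hx : x ∈ F (h + (N x + N y)) := hF (by omega) (hN x)
    have hy : y ∈ F (h + (N x + N y)) := hF (by omega) (hN y)
    rw [he' (N x) _ x (hN x) hx, he' (N y) _ y (hN y) hy, ← map_add]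
    exact he' _ _ _ _ _
  · intro c x
    rw [RingHom.id_apply, ← map_smul]
    exact he' _ _ _ _ _
  · exact he' _ 0 _ _ x.2

end Retraction

theorem grTensor_injective (hF : Monotone F) (hG : Monotone G)
    (hFp : ∀ n, Module.Projective (Env K A) (Gr F n))
    (hGp : ∀ n, Module.Projective (Env K A) (Gr G n))
    (hFe : ∀ m, ∃ n, m ∈ F n) (hGe : ∀ m, ∃ n, m ∈ G n) (n : ℕ) :
    Function.Injective (grTensor F G n) := by
  choose r hr using exists_extension hF hFp hFe
  choose q hq using exists_extension hG hGp hGe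
  have hr0 : ∀ h i, i < h → ∀ x ∈ F i, r h x = 0 := by
    intro h i hi x hx
    obtain ⟨k, rfl⟩ : ∃ k, h = k + 1 := ⟨h - 1, by omega⟩
    have hx' : x ∈ F k := hF (by omega) hx
    rw [hr (k + 1) ⟨x, hF (by omega) hx'⟩]
    exact Gr.mk_eq_zero.2 hx'
  have hq0 : ∀ h i, i < h → ∀ x ∈ G i, q h x = 0 := by
    intro h i hi x hx
    obtain ⟨k, rfl⟩ : ∃ k, h = k + 1 := ⟨h - 1, by omega⟩
    have hx' : x ∈ G k := hG (by omega) hx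
    rw [hq (k + 1) ⟨x, hG (by omega) hx'⟩]
    exact Gr.mk_eq_zero.2 hx'
  have hz : ∀ i j, i + j = n → ∀ z ∈ prev (tensorFil F G) n,
      BTensor.map (r i) (q j) z = 0 := by
    rintro i j rfl z hz
    cases hn : i + j with
    | zero =>
      rw [hn] at hz
      have : z = 0 := hz
      rw [this, map_zero]
    | succ m =>
      rw [hn] at hz
      have hz' : z ∈ tensorFil F G m := hz
      clear hz
      induction hz' using Submodule.span_induction with
      | mem z hz =>
        obtain ⟨i', j', hij, x, hx, y, hy, rfl⟩ := hz
        rw [BTensor.map_tmul]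
        rcases lt_or_ge i' i with hi | hi
        · rw [hr0 i i' hi x hx]; simp [BTensor.tmul]
        · rw [hq0 j j' (by omega) y hy]; simp
      | zero => rw [map_zero]
      | add x y hx' hy' hx hy => rw [map_add, hx, hy, add_zero]
      | smul e z hz' hz => rw [map_smul, hz, smul_zero]
  let θ : ∀ p : Finset.HasAntidiagonal.antidiagonal n,
      Gr (tensorFil F G) n →ₗ[K] BTensor K A (Gr F p.1.1) (Gr G p.1.2) := fun p =>
    Gr.lift _ (((BTensor.map (r p.1.1) (q p.1.2)).comp
      (tensorFil F G n).subtype).restrictScalars K)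
      (fun z h => hz _ _ (Finset.HasAntidiagonal.mem_antidiagonal.1 p.2) z h)
  have hθ : ∀ p, θ p ∘ₗ grTensor F G n = DirectSum.component K _ _ p := by
    intro p
    refine DirectSum.linearMap_ext K fun p' => BTensor.hom_ext fun x y => ?_
    obtain ⟨x, rfl⟩ := Gr.mk_surjective x
    obtain ⟨y, rfl⟩ := Gr.mk_surjective y
    simp only [LinearMap.comp_apply]
    rw [grTensor_of, grTensorComp_tmul]
    have h1 : θ p (Gr.mk (tensorFil F G) n ⟨BTensor.tmul K A (x : M) (y : N),
        tmul_mem_tensorFil F G (Finset.HasAntidiagonal.mem_antidiagonal.1 p'.2) x.2 y.2⟩) =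
        BTensor.tmul K A (r p.1.1 x) (q p.1.2 y) := BTensor.map_tmul _ _ _ _
    rw [h1]
    by_cases hp : p' = p
    · subst hp
      rw [hr, hq, DirectSum.component.lof_self]
    · have hne : p'.1.1 ≠ p.1.1 := by
        intro h
        have h1 := Finset.HasAntidiagonal.mem_antidiagonal.1 p'.2
        have h2 := Finset.HasAntidiagonal.mem_antidiagonal.1 p.2
        exact hp (Subtype.ext (Prod.ext h (by omega)))
      have h2 := Finset.HasAntidiagonal.mem_antidiagonal.1 p'.2
      have h3 := Finset.HasAntidiagonal.mem_antidiagonal.1 p.2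
      rw [DirectSum.component.of, dif_neg hp]
      rcases lt_or_gt_of_ne hne with hi | hi
      · rw [hr0 _ _ hi x x.2]; simp [BTensor.tmul]
      · rw [hq0 p.1.2 p'.1.2 (by omega) y y.2]; simp
  refine (injective_iff_map_eq_zero _).2 fun z hz0 => ?_
  refine DirectSum.ext_component K fun p => ?_
  rw [← hθ p, LinearMap.comp_apply, hz0, map_zero, map_zero]

end Filtration

section FilteredCoring

variable {K A} {C : Type*} [AddCommGroup C] [Module K C] [Module (Env K A) C]
  [IsScalarTower K (Env K A) C]

/-- `F` makes the `A`-coring `C` into a graded projective filtered `A`-coring: it is an exhaustive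
increasing filtration by subbimodules, the components `gr_n(C)` are projective bimodules, and the
comultiplication is filtered. -/
structure IsGradedProjectiveFiltered (D : Coring K A C) (F : ℕ → Submodule (Env K A) C) :
    Prop where
  mono : Monotone F
  exhaustive : ∀ c, ∃ n, c ∈ F n
  projective : ∀ n, Module.Projective (Env K A) (Gr F n)
  comul_mem : ∀ n, ∀ c ∈ F n, D.comul c ∈ tensorFil F F n

namespace IsGradedProjectiveFiltered

variable {D : Coring K A C} {F : ℕ → Submodule (Env K A) C}

/-- For a graded projective filtered coring, the canonical map is an isomorphism
`(gr(C) ⊗_A gr(C))_n ≅ gr_n(C ⊗_A C)`. -/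
def grTensorEquiv (h : IsGradedProjectiveFiltered D F) (n : ℕ) :
    (⨁ p : Finset.HasAntidiagonal.antidiagonal n, BTensor K A (Gr F p.1.1) (Gr F p.1.2)) ≃ₗ[K]
      Gr (tensorFil F F) n :=
  LinearEquiv.ofBijective (grTensor F F n)
    ⟨grTensor_injective F F h.mono h.mono h.projective h.projective h.exhaustive h.exhaustive n,
      grTensor_surjective F F n⟩

theorem comul_mem_prev (h : IsGradedProjectiveFiltered D F) (n : ℕ) (c : C) (hc : c ∈ prev F n) :
    D.comul c ∈ prev (tensorFil F F) n := by
  cases n with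
  | zero =>
    have : c = 0 := hc
    rw [this, map_zero]
    exact zero_mem _
  | succ n => exact h.comul_mem n c hc

/-- The restriction `F_n(C) → F_n(C ⊗_A C)` of the comultiplication. -/
def filComul (h : IsGradedProjectiveFiltered D F) (n : ℕ) : F n →ₗ[K] tensorFil F F n :=
  (D.comul.restrict (h.comul_mem n)).restrictScalars K

/-- The map `gr_n(Δ) : gr_n(C) → gr_n(C ⊗_A C)` induced by the comultiplication. -/
def grMapComul (h : IsGradedProjectiveFiltered D F) (n : ℕ) :
    Gr F n →ₗ[K] Gr (tensorFil F F) n :=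
  Gr.lift F (((Gr.mk (tensorFil F F) n).restrictScalars K).comp (h.filComul n))
    (fun x hx => Gr.mk_eq_zero.2 (h.comul_mem_prev n x hx))

/-- The degree `n` part `gr_n(C) → ⨁_{i+j=n} gr_i(C) ⊗_A gr_j(C)` of the comultiplication of the
graded `A`-coring `gr(C)`: the map `gr_n(Δ)` followed by the inverse of the canonical
isomorphism. -/
def grComul (h : IsGradedProjectiveFiltered D F) (n : ℕ) :
    Gr F n →ₗ[K]
      ⨁ p : Finset.HasAntidiagonal.antidiagonal n, BTensor K A (Gr F p.1.1) (Gr F p.1.2) :=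
  (h.grTensorEquiv n).symm.toLinearMap.comp (h.grMapComul n)

/-- The component `Δ^{[i,j]} : gr_{i+j}(C) → gr_i(C) ⊗_A gr_j(C)` of the comultiplication of
`gr(C)`. -/
def grComulComp (h : IsGradedProjectiveFiltered D F) (i j : ℕ) :
    Gr F (i + j) →ₗ[K] BTensor K A (Gr F i) (Gr F j) :=
  (DirectSum.component K (Finset.HasAntidiagonal.antidiagonal (i + j))
    (fun p => BTensor K A (Gr F p.1.1) (Gr F p.1.2))
    ⟨(i, j), Finset.HasAntidiagonal.mem_antidiagonal.2 rfl⟩).comp (h.grComul (i + j))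

/-- The graded `A`-coring `gr(C)` is strongly graded: every `Δ^{[i,j]}` is injective. -/
def GrStronglyGraded (h : IsGradedProjectiveFiltered D F) : Prop :=
  ∀ i j, Function.Injective (h.grComulComp i j)

end IsGradedProjectiveFiltered

end FilteredCoring

end Tensor

/-- An `Aᵉ`-ring: a `K`-algebra with a `K`-algebra map `η` from `Aᵉ = A ⊗ Aᵒᵖ`. -/
structure EnvRing (K : Type u) (A : Type v) [Field K] [Ring A] [Algebra K A] where
  /-- The underlying type. -/
  carrier : Type w
  [ring : Ring carrier]
  [algebra : Algebra K carrier]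
  /-- The structure map. -/
  eta : Env K A →ₐ[K] carrier

attribute [instance] EnvRing.ring EnvRing.algebra

namespace EnvRing

variable {K : Type u} {A : Type v} [Field K] [Ring A] [Algebra K A]

instance : CoeSort (EnvRing.{u, v, w} K A) (Type w) := ⟨EnvRing.carrier⟩

variable (R : EnvRing.{u, v, w} K A)

/-- The bimodule `_η R`: the enveloping algebra acts through `η` by left multiplication. -/
instance : Module (Env K A) R.carrier := Module.compHom R.carrier R.eta.toRingHom

theorem smul_def (x : Env K A) (r : R) : x • r = R.eta x * r := rfl

instance : IsScalarTower K (Env K A) R.carrier :=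
  ⟨fun k x r => by simp [smul_def]⟩

/-- The source map `s(a) = η(a ⊗ 1)`. -/
def s : A →ₐ[K] R := R.eta.comp (Env.includeLeft K A)

/-- The target map `t(aᵒᵖ) = η(1 ⊗ aᵒᵖ)`. -/
def t : Aᵐᵒᵖ →ₐ[K] R := R.eta.comp (Env.includeRight K A)

theorem s_mul (a : A) (r : R) : R.s a * r = lact K A R a r := rfl

theorem t_mul (a : A) (r : R) : R.t (MulOpposite.op a) * r = ract K A R a r := rfl

theorem eta_tmul (a : A) (b : Aᵐᵒᵖ) : R.eta (Env.tmul K a b) = R.s a * R.t b := by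
  simp [s, t, ← map_mul, Env.includeLeft_apply, Env.includeRight_apply, Env.tmul_mul_tmul]

/-- Right multiplication of `R ⊗_A R` by `ξ ⊗ ζ`: `m ⊗_A n ↦ m ξ ⊗_A n ζ`. -/
def rmul (x y : R) : BTensor K A R R →ₗ[K] BTensor K A R R :=
  BTensor.mapAux (LinearMap.mulRight K x) (LinearMap.mulRight K y)
    (fun a m => by simp [← t_mul, mul_assoc]) (fun a m => by simp [← s_mul, mul_assoc])

@[simp] theorem rmul_tmul (x y m n : R) :
    R.rmul x y (BTensor.tmul K A m n) = BTensor.tmul K A (m * x) (n * y) :=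
  BTensor.mapAux_tmul (LinearMap.mulRight K x) (LinearMap.mulRight K y) _ _ m n

/-- The Takeuchi product `R ×_A R`: the elements `∑ mᵢ ⊗_A nᵢ` of `R ⊗_A R` such that
`∑ mᵢ t(aᵒᵖ) ⊗_A nᵢ = ∑ mᵢ ⊗_A nᵢ s(a)` for all `a`. -/
def takeuchi : Submodule K (BTensor K A R R) where
  carrier := {z | ∀ a : A, R.rmul (R.t (MulOpposite.op a)) 1 z = R.rmul 1 (R.s a) z}
  add_mem' hx hy a := by rw [map_add, map_add, hx a, hy a]
  zero_mem' a := by rw [map_zero, map_zero]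
  smul_mem' k x hx a := by rw [map_smul, map_smul, hx a]

/-- The bilinear map `(ξ', ζ') ↦ ∑ ξ ξ' ⊗_A ζ ζ'`, for `u = ∑ ξ ⊗_A ζ`. -/
def preMul (u : BTensor K A R R) : R.carrier →ₗ[K] R.carrier →ₗ[K] BTensor K A R R :=
  LinearMap.mk₂ K (fun x y => R.rmul x y u)
    (fun x x' y => by
      induction u using BTensor.induction with
      | h0 => simp
      | ht m n => simp [BTensor.tmul, mul_add]
      | ha a b ha hb => simp only [map_add, ha, hb]; abel)
    (fun k x y => by
      induction u using BTensor.induction with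
      | h0 => simp
      | ht m n => simp [BTensor.tmul]
      | ha a b ha hb => simp only [map_add, ha, hb, smul_add])
    (fun x y y' => by
      induction u using BTensor.induction with
      | h0 => simp
      | ht m n => simp [BTensor.tmul, mul_add]
      | ha a b ha hb => simp only [map_add, ha, hb]; abel)
    (fun k x y => by
      induction u using BTensor.induction with
      | h0 => simp
      | ht m n => simp [BTensor.tmul]
      | ha a b ha hb => simp only [map_add, ha, hb, smul_add])

@[simp] theorem preMul_apply (u : BTensor K A R R) (x y : R) :
    R.preMul u x y = R.rmul x y u := rfl

theorem rmul_rmul (x y x' y' : R) (u : BTensor K A R R) :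
    R.rmul x y (R.rmul x' y' u) = R.rmul (x' * x) (y' * y) u := by
  induction u using BTensor.induction with
  | h0 => simp
  | ht m n => simp [mul_assoc]
  | ha a b ha hb => simp only [map_add, ha, hb]

/-- The componentwise product `(∑ ξ ⊗_A ζ) (∑ ξ' ⊗_A ζ') = ∑ ξ ξ' ⊗_A ζ ζ'`, which is well defined
when the left factor lies in the Takeuchi product. -/
def takMul (u : R.takeuchi) : BTensor K A R R →ₗ[K] BTensor K A R R :=
  BTensor.lift K A (R.preMul u) (fun a m n => by
    have h := congrArg (R.rmul m n) (u.2 a)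
    simpa only [rmul_rmul, one_mul, preMul_apply, t_mul, s_mul] using h)

@[simp] theorem takMul_tmul (u : R.takeuchi) (m n : R) :
    R.takMul u (BTensor.tmul K A m n) = R.rmul m n u := by
  simp [takMul]

/-- Morphisms of `Aᵉ`-rings. -/
structure Hom (R : EnvRing.{u, v, w} K A) (S : EnvRing.{u, v, w'} K A) extends
    R.carrier →ₐ[K] S.carrier where
  map_s : ∀ a, toFun (R.s a) = S.s a
  map_t : ∀ a, toFun (R.t a) = S.t a

namespace Hom

variable {R} {S : EnvRing.{u, v, w'} K A}

theorem map_eta (f : Hom R S) (x : Env K A) : f.toAlgHom (R.eta x) = S.eta x := by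
  induction x using Env.induction with
  | h0 => simp
  | ht a b =>
    have h1 : f.toAlgHom (R.s a) = S.s a := f.map_s a
    have h2 : f.toAlgHom (R.t b) = S.t b := f.map_t b
    rw [eta_tmul, eta_tmul, map_mul, h1, h2]
  | ha x y hx hy => simp only [map_add, hx, hy]

/-- A morphism of `Aᵉ`-rings is a bimodule map. -/
def toBimoduleMap (f : Hom R S) : R.carrier →ₗ[Env K A] S.carrier where
  toFun := f.toAlgHom
  map_add' := map_add f.toAlgHom
  map_smul' x r := by
    rw [smul_def, map_mul, map_eta, RingHom.id_apply, smul_def]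

end Hom

end EnvRing

/-- A left `A`-bialgebroid. -/
structure LeftBialgebroid (K : Type u) (A : Type v) [Field K] [Ring A] [Algebra K A] where
  /-- The total algebra, as an `Aᵉ`-ring. -/
  total : EnvRing.{u, v, w} K A
  /-- The `A`-coring structure on the bimodule `_η B`. -/
  coring : Coring K A total
  comul_mem : ∀ x, coring.comul x ∈ total.takeuchi
  comul_one : coring.comul 1 = BTensor.tmul K A 1 1
  comul_mul : ∀ x y, coring.comul (x * y) =
    total.takMul ⟨coring.comul x, comul_mem x⟩ (coring.comul y)
  counit_mul_s : ∀ x y, coring.counit (x * total.s (coring.counit y)) = coring.counit (x * y)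
  counit_mul_t : ∀ x y, coring.counit (x * total.t (MulOpposite.op (coring.counit y))) =
    coring.counit (x * y)
  counit_one : coring.counit 1 = 1

namespace LeftBialgebroid

variable {K : Type u} {A : Type v} [Field K] [Ring A] [Algebra K A]

instance : CoeSort (LeftBialgebroid.{u, v, w} K A) (Type w) := ⟨fun B => B.total.carrier⟩

/-- Morphisms of left `A`-bialgebroids. -/
structure Hom (B : LeftBialgebroid.{u, v, w} K A) (B' : LeftBialgebroid.{u, v, w'} K A) extends
    EnvRing.Hom B.total B'.total where
  counit_comp : ∀ x, B'.coring.counit (toHom.toBimoduleMap x) = B.coring.counit x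
  comul_comp : ∀ x, BTensor.map toHom.toBimoduleMap toHom.toBimoduleMap (B.coring.comul x) =
    B'.coring.comul (toHom.toBimoduleMap x)

instance (B : LeftBialgebroid.{u, v, w} K A) (B' : LeftBialgebroid.{u, v, w'} K A) :
    CoeFun (Hom B B') (fun _ => B → B') := ⟨fun f => f.toAlgHom⟩

variable (B : LeftBialgebroid.{u, v, w} K A)

/-- The space of primitive elements. -/
def prim : Submodule K B where
  carrier := {X | B.coring.comul X = BTensor.tmul K A X 1 + BTensor.tmul K A 1 X}
  add_mem' {x y} hx hy := by
    change B.coring.comul (x + y) = BTensor.tmul K A (x + y) 1 + BTensor.tmul K A 1 (x + y)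
    have hx' : B.coring.comul x = _ := hx
    have hy' : B.coring.comul y = _ := hy
    simp only [map_add, hx', hy', BTensor.tmul, LinearMap.add_apply]
    abel
  zero_mem' := by
    change B.coring.comul 0 = BTensor.tmul K A 0 1 + BTensor.tmul K A 1 0
    simp [BTensor.tmul]
  smul_mem' k x hx := by
    change B.coring.comul (k • x) = BTensor.tmul K A (k • x) 1 + BTensor.tmul K A 1 (k • x)
    have hx' : B.coring.comul x = _ := hx
    rw [← LinearMap.coe_restrictScalars K B.coring.comul, map_smul]
    simp only [LinearMap.coe_restrictScalars, hx', map_smul, BTensor.tmul, LinearMap.smul_apply,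
      smul_add]

theorem mem_prim {X : B} : X ∈ B.prim ↔
    B.coring.comul X = BTensor.tmul K A X 1 + BTensor.tmul K A 1 X := Iff.rfl

/-- The image of `Aᵉ ⊗ Prim(B) ⊗ Aᵉ → B`, `x ⊗ X ⊗ y ↦ η(x) X η(y)`. -/
def primImage : Submodule K B :=
  Submodule.span K {z | ∃ (x : Env K A) (X : B) (y : Env K A), X ∈ B.prim ∧
    z = B.total.eta x * X * B.total.eta y}

theorem eta_mul_mem_primImage (x : Env K A) {z : B} (hz : z ∈ B.primImage) :
    B.total.eta x * z ∈ B.primImage := by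
  refine Submodule.span_induction ?_ ?_ ?_ ?_ hz
  · rintro _ ⟨a, X, b, hX, rfl⟩
    refine Submodule.subset_span ⟨x * a, X, b, hX, ?_⟩
    simp only [map_mul, mul_assoc]
  · rw [mul_zero]
    exact zero_mem _
  · intro u v _ _ hu hv
    rw [mul_add]
    exact add_mem hu hv
  · intro k u _ hu
    rw [mul_smul_comm]
    exact Submodule.smul_mem _ k hu

/-- The image in `B` of the degree `k` component `M ⊗_{Aᵉ} ⋯ ⊗_{Aᵉ} M` (`k` factors) of the tensor
`Aᵉ`-ring on `M = Aᵉ ⊗ Prim(B) ⊗ Aᵉ`, as a `K`-subspace: it is `η(Aᵉ)` for `k = 0`, and the span of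
the products of `k` elements of the image of `M` for `k ≥ 1`. -/
def tensorImageAux : ℕ → Submodule K B
  | 0 => LinearMap.range B.total.eta.toLinearMap
  | k + 1 => B.primImage * tensorImageAux k

/-- The image in `B` of the degree `k` component of the tensor `Aᵉ`-ring on
`Aᵉ ⊗ Prim(B) ⊗ Aᵉ`. -/
def tensorImage (k : ℕ) : Submodule (Env K A) B where
  carrier := B.tensorImageAux k
  add_mem' := add_mem
  zero_mem' := zero_mem _
  smul_mem' x z hz := by
    rw [EnvRing.smul_def]
    cases k with
    | zero =>
      obtain ⟨y, rfl⟩ := hz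
      exact ⟨x * y, map_mul B.total.eta x y⟩
    | succ k =>
      change z ∈ B.primImage * B.tensorImageAux k at hz
      change B.total.eta x * z ∈ B.primImage * B.tensorImageAux k
      induction hz using Submodule.mul_induction_on' with
      | mem_mul_mem u hu v hv =>
        rw [← mul_assoc]
        exact Submodule.mul_mem_mul (B.eta_mul_mem_primImage x hu) hv
      | add u _ v _ hu hv =>
        rw [mul_add]
        exact add_mem hu hv

/-- The primitive filtration: `F_n(B)` is the image of the degrees `≤ n` of the tensor
`Aᵉ`-ring on `Aᵉ ⊗ Prim(B) ⊗ Aᵉ`. -/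
def primFil (n : ℕ) : Submodule (Env K A) B := ⨆ k : Fin (n + 1), B.tensorImage k

/-- `B` is primitively generated: the primitive filtration is exhaustive. -/
def IsPrimitivelyGenerated : Prop := ∀ b : B, ∃ n, b ∈ B.primFil n

/-- `B` is graded projective: the components of the graded module associated to the primitive
filtration are projective left `Aᵉ`-modules. -/
def IsGradedProjective : Prop := ∀ n, Module.Projective (Env K A) (Gr B.primFil n)

theorem tensorImage_le_primFil {k n : ℕ} (h : k ≤ n) : B.tensorImage k ≤ B.primFil n :=
  le_iSup_of_le (⟨k, Nat.lt_succ_of_le h⟩ : Fin (n + 1)) le_rfl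

theorem primFil_mono : Monotone B.primFil := fun _ _ h =>
  iSup_le fun k => B.tensorImage_le_primFil ((Nat.le_of_lt_succ k.2).trans h)

theorem one_mem_primFil_zero : (1 : B) ∈ B.primFil 0 :=
  B.tensorImage_le_primFil le_rfl ⟨1, map_one B.total.eta⟩

theorem prim_mul_mem_primFil {X z : B} (hX : X ∈ B.prim) {n : ℕ} (hz : z ∈ B.primFil n) :
    X * z ∈ B.primFil (n + 1) := by
  have hX' : X ∈ B.primImage := Submodule.subset_span ⟨1, X, 1, hX, by simp⟩
  refine Submodule.iSup_induction (fun k : Fin (n + 1) => B.tensorImage k)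
    (motive := fun z => X * z ∈ B.primFil (n + 1)) hz ?_ ?_ ?_
  · intro k z hz
    have h : X * z ∈ B.tensorImageAux (k + 1) := Submodule.mul_mem_mul hX' hz
    exact B.tensorImage_le_primFil (Nat.succ_le_of_lt (Nat.succ_lt_succ k.2) |> Nat.le_of_lt_succ) h
  · rw [mul_zero]
    exact zero_mem _
  · intro x y hx hy
    rw [mul_add]
    exact add_mem hx hy

theorem takMul_prim_mem {X : B} (hX : X ∈ B.prim) {n : ℕ} {z : BTensor K A B B}
    (hz : z ∈ tensorFil B.primFil B.primFil n) :
    B.total.takMul ⟨B.coring.comul X, B.comul_mem X⟩ z ∈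
      tensorFil B.primFil B.primFil (n + 1) := by
  have hz' := mem_span_of_mem_tensorFil _ _ hz
  clear hz
  induction hz' using Submodule.span_induction with
  | mem z hz =>
    obtain ⟨i, j, hij, x, hx, y, hy, rfl⟩ := hz
    rw [EnvRing.takMul_tmul]
    have hX' : B.coring.comul X = _ := hX
    simp only [hX', map_add]
    rw [EnvRing.rmul_tmul, EnvRing.rmul_tmul, one_mul, one_mul]
    exact add_mem
      (tmul_mem_tensorFil _ _ (by omega) (B.prim_mul_mem_primFil hX hx) hy)
      (tmul_mem_tensorFil _ _ (by omega) hx (B.prim_mul_mem_primFil hX hy))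
  | zero => rw [map_zero]; exact zero_mem _
  | add x y _ _ hx hy => rw [map_add]; exact add_mem hx hy
  | smul k z _ hz =>
    rw [map_smul]
    exact ((tensorFil B.primFil B.primFil (n + 1)).restrictScalars K).smul_mem k hz

theorem tensorFil_mono : Monotone (tensorFil B.primFil B.primFil) := by
  intro m n hmn
  refine Submodule.span_le.2 ?_
  rintro _ ⟨i, j, hij, x, hx, y, hy, rfl⟩
  exact tmul_mem_tensorFil _ _ (by omega : i + (n - i) = n) hx (B.primFil_mono (by omega) hy)

theorem comul_mem_of_mem_tensorImage (k : ℕ) : ∀ z ∈ B.tensorImage k,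
    B.coring.comul z ∈ tensorFil B.primFil B.primFil k := by
  induction k with
  | zero =>
    intro z hz
    obtain ⟨x, hx⟩ : ∃ x : Env K A, B.total.eta x = z := hz
    have h : z = x • (1 : B) := by rw [EnvRing.smul_def, mul_one, hx]
    have h' : B.coring.comul z = x • BTensor.tmul K A (1 : B) (1 : B) := by
      rw [h, map_smul, B.comul_one]
    rw [h']
    exact Submodule.smul_mem _ x
      (tmul_mem_tensorFil B.primFil B.primFil (i := 0) (j := 0) (Nat.add_zero 0)
        B.one_mem_primFil_zero B.one_mem_primFil_zero)
  | succ k ih =>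
    intro z hz
    change z ∈ B.primImage * B.tensorImageAux k at hz
    refine Submodule.mul_induction_on (C := fun z =>
      B.coring.comul z ∈ tensorFil B.primFil B.primFil (k + 1)) hz ?_ ?_
    · intro u hu v hv
      refine Submodule.span_induction (p := fun u _ =>
        B.coring.comul (u * v) ∈ tensorFil B.primFil B.primFil (k + 1)) ?_ ?_ ?_ ?_ hu
      · rintro _ ⟨x, X, y, hX, rfl⟩
        have h : B.total.eta x * X * B.total.eta y * v = x • (X * (y • v)) := by
          simp only [EnvRing.smul_def, mul_assoc]
        rw [h, map_smul, B.comul_mul]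
        exact Submodule.smul_mem _ x
          (B.takMul_prim_mem hX (ih _ ((B.tensorImage k).smul_mem y hv)))
      · rw [zero_mul, map_zero]
        exact zero_mem _
      · intro a b _ _ ha hb
        rw [add_mul, map_add]
        exact add_mem ha hb
      · intro c a _ ha
        have h : B.coring.comul (c • a * v) = c • B.coring.comul (a * v) := by
          rw [smul_mul_assoc]
          exact map_smul (B.coring.comul.restrictScalars K) c (a * v)
        rw [h]
        exact ((tensorFil B.primFil B.primFil (k + 1)).restrictScalars K).smul_mem c ha
    · intro u v hu hv
      rw [map_add]
      exact add_mem hu hv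

theorem comul_mem_of_mem_primFil (n : ℕ) (z : B) (hz : z ∈ B.primFil n) :
    B.coring.comul z ∈ tensorFil B.primFil B.primFil n := by
  have h : B.primFil n ≤ (tensorFil B.primFil B.primFil n).comap B.coring.comul :=
    iSup_le fun k z hz => B.tensorFil_mono (Nat.le_of_lt_succ k.2)
      (B.comul_mem_of_mem_tensorImage k z hz)
  exact h hz

variable {B} in
/-- A graded projective primitively generated bialgebroid is a graded projective filtered
`A`-coring with the primitive filtration. -/
theorem isGradedProjectiveFiltered (hgen : B.IsPrimitivelyGenerated)
    (hproj : B.IsGradedProjective) : IsGradedProjectiveFiltered B.coring B.primFil where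
  mono := B.primFil_mono
  exhaustive := hgen
  projective := hproj
  comul_mem := B.comul_mem_of_mem_primFil

end LeftBialgebroid

end Bialgd

end

/-! This is a Heyneman–Radford type argument on associated graded corings. A morphism `φ` sends
primitives to primitives, hence respects the primitive filtrations. These are exhaustive and start
from `F_{-1} = 0`, so it is enough that every `gr_n(φ)` is injective
(`injective_of_grMap_injective`).

Since `φ` commutes with the comultiplications, a class `z` in degree `n + 1` killed by `gr(φ)`
satisfies `(gr_n(φ) ⊗_A gr_1(φ)) (Δ^{[n,1]} z) = 0` (`map_grComulComp_eq_zero`). If `gr_n(φ)` and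
`gr_1(φ)` are injective, so is their tensor product. Indeed, `Aᵉ` is free over `A` on either side
because `K` is a field, so projective bimodules are projective, and hence flat, as one-sided
`A`-modules (`BTensor.map_injective`). Strong grading of `gr(B)` then gives `z = 0`, and induction
on `n` reduces everything to degrees `0` and `1`.

In these degrees the hypothesis on `Aᵉ · Prim(B)` does not visibly control `η(Aᵉ)`; the counit
bridges the gap. Commutators of primitives with `η(Aᵉ)` lie in `η(Aᵉ)`, so `F_1 = η(Aᵉ) + Aᵉ ·
Prim(B)` (`mem_primFil_one`). The counit kills `Aᵉ · Prim(B)` and is preserved by `φ`, so the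
`η`-part of an element of `F_1 ∩ ker φ` has counit zero. Such an `η(x)` already lies in `Aᵉ ·
Prim(B)`, because each `s(a) - t(a)` is primitive. Thus `φ` is injective on `F_1`
(`eq_zero_of_mem_primFil_one`), and this yields injectivity of `gr_0(φ)` and `gr_1(φ)`. -/

noncomputable section

namespace Bialgd

set_option linter.unusedSectionVars false

universe u v w w'

/-! ### One-sided dual bases and flatness of projective bimodules. -/

section DualBasis

variable {K : Type u} {A : Type v} [Field K] [Ring A] [Algebra K A]
variable {M N M' N' : Type*}
  [AddCommGroup M] [Module K M] [Module (Env K A) M] [IsScalarTower K (Env K A) M]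
  [AddCommGroup N] [Module K N] [Module (Env K A) N] [IsScalarTower K (Env K A) N]
  [AddCommGroup M'] [Module K M'] [Module (Env K A) M'] [IsScalarTower K (Env K A) M']
  [AddCommGroup N'] [Module K N'] [Module (Env K A) N'] [IsScalarTower K (Env K A) N']

variable (K A) in
/-- The linear map `a ↦ a · n`. -/
def lactOn (n : N) : A →ₗ[K] N :=
  (BTensor.lUnit K A N).comp ((BTensor.mk K A A N).flip n)

@[simp] theorem lactOn_apply (n : N) (a : A) : lactOn K A n a = lact K A N a n :=
  BTensor.lUnit_tmul K A N a n

variable (K A) in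
/-- The linear map `a ↦ m · a`. -/
def ractOn (m : M) : A →ₗ[K] M :=
  (BTensor.rUnit K A M).comp (BTensor.mk K A M A m)

@[simp] theorem ractOn_apply (m : M) (a : A) : ractOn K A m a = ract K A M a m :=
  BTensor.rUnit_tmul K A M m a

variable (K A N) in
open Classical in
/-- A projective `Aᵉ`-module has a dual basis as a left `A`-module. -/
theorem exists_left_dualBasis [hN : Module.Projective (Env K A) N] :
    ∃ (κ : Type v) (e : N × κ → N) (c : N →ₗ[K] N × κ →₀ A),
      (∀ a n i, c (lact K A N a n) i = a * c n i) ∧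
      ∀ n, ((c n).sum fun i a => lact K A N a (e i)) = n := by
  -- `s` is an `Aᵉ`-linear section of the free cover of `N` by `N →₀ Env K A`.
  obtain ⟨s, hs⟩ := hN.1
  let b := Module.Basis.ofVectorSpace K Aᵐᵒᵖ
  -- A `K`-basis `b` of `Aᵐᵒᵖ` makes `Aᵉ` a free left `A`-module on the elements `1 ⊗ b k`; `E`
  -- reads off the coordinates.
  let E : Env K A ≃ₗ[K] _ →₀ A := TensorProduct.equivFinsuppOfBasisRight (M := A) b
  have hEt : ∀ a x k, E (Env.tmul K a x) k = b.repr x k • a := fun a x k =>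
    TensorProduct.equivFinsuppOfBasisRight_apply_tmul_apply b a x k
  have hEs : ∀ a k, E.symm (Finsupp.single k a) = Env.tmul K a (b k) := fun a k => by
    rw [LinearEquiv.symm_apply_eq]
    ext j
    simp [hEt, Finsupp.single_apply, ite_smul]
  have hE : ∀ a y k, E (Env.tmul K a 1 * y) k = a * E y k := by
    intro a y k
    induction y using Env.induction with
    | h0 => simp
    | ht a' x => rw [Env.tmul_mul_tmul, one_mul, hEt, hEt, mul_smul_comm]
    | ha x y hx hy => rw [mul_add, map_add, map_add, Finsupp.add_apply, Finsupp.add_apply, hx, hy,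
        mul_add]
  let C : (N →₀ Env K A) ≃ₗ[K] N × _ →₀ A :=
    (Finsupp.mapRange.linearEquiv E).trans (Finsupp.curryLinearEquiv K).symm
  have hC : ∀ x n k, C x (n, k) = E (x n) k := fun x n k => rfl
  let e : N × _ → N := fun i => Env.tmul K 1 (b i.2) • i.1
  -- Recombining the `A`-coordinates along `e` is the free cover itself: `(a ⊗ b k) • n = a · ((1 ⊗
  -- b k) • n)`. Composing with `s` gives the dual basis identity.
  have hR : Finsupp.lsum K (fun i => lactOn K A (e i)) ∘ₗ C.toLinearMap =
      (Finsupp.linearCombination (Env K A) (id : N → N)).restrictScalars K := by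
    rw [← LinearEquiv.eq_comp_toLinearMap_symm]
    ext ⟨n, k⟩ a
    have h : C.symm (Finsupp.single (n, k) a) = Finsupp.single n (Env.tmul K a (b k)) := by
      rw [← hEs]
      simp [C, Finsupp.curryLinearEquiv]
    simp [h, e, lact_apply, ← mul_smul, Env.tmul_mul_tmul]
  refine ⟨_, e, C.toLinearMap ∘ₗ s.restrictScalars K, ?_, ?_⟩
  · rintro a n ⟨n', k⟩
    simp [hC, lact_apply, hE]
  · intro n
    have h := LinearMap.congr_fun hR (s n)
    simp only [LinearMap.comp_apply, LinearMap.restrictScalars_apply, hs n, Finsupp.lsum_apply]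
      at h
    exact h

variable (K A M) in
open Classical in
/-- A projective `Aᵉ`-module has a dual basis as a right `A`-module. -/
theorem exists_right_dualBasis [hM : Module.Projective (Env K A) M] :
    ∃ (κ : Type v) (e : M × κ → M) (c : M →ₗ[K] M × κ →₀ A),
      (∀ a m i, c (ract K A M a m) i = c m i * a) ∧
      ∀ m, ((c m).sum fun i a => ract K A M a (e i)) = m := by
  obtain ⟨s, hs⟩ := hM.1
  let b := Module.Basis.ofVectorSpace K A
  -- Here the basis is of `A`, and the coordinates in `Aᵐᵒᵖ` are read in `A`, so that the right
  -- action becomes right multiplication of coordinates.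
  let E : Env K A ≃ₗ[K] _ →₀ A :=
    (TensorProduct.equivFinsuppOfBasisLeft (N := Aᵐᵒᵖ) b).trans
      (Finsupp.mapRange.linearEquiv (MulOpposite.opLinearEquiv K).symm)
  have hEt : ∀ a x k, E (Env.tmul K a x) k = b.repr a k • x.unop := fun a x k =>
    congrArg MulOpposite.unop (TensorProduct.equivFinsuppOfBasisLeft_apply_tmul_apply b a x k)
  have hEs : ∀ a k, E.symm (Finsupp.single k a) = Env.tmul K (b k) (MulOpposite.op a) := by
    intro a k
    rw [LinearEquiv.symm_apply_eq]
    ext j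
    simp [hEt, Finsupp.single_apply, ite_smul]
  have hE : ∀ a y k, E (Env.tmul K 1 (MulOpposite.op a) * y) k = E y k * a := by
    intro a y k
    induction y using Env.induction with
    | h0 => simp
    | ht a' x => rw [Env.tmul_mul_tmul, one_mul, hEt, hEt, MulOpposite.unop_mul,
        MulOpposite.unop_op, smul_mul_assoc]
    | ha x y hx hy => rw [mul_add, map_add, map_add, Finsupp.add_apply, Finsupp.add_apply, hx, hy,
        add_mul]
  let C : (M →₀ Env K A) ≃ₗ[K] M × _ →₀ A :=
    (Finsupp.mapRange.linearEquiv E).trans (Finsupp.curryLinearEquiv K).symm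
  have hC : ∀ x n k, C x (n, k) = E (x n) k := fun x n k => rfl
  let e : M × _ → M := fun i => Env.tmul K (b i.2) 1 • i.1
  have hR : Finsupp.lsum K (fun i => ractOn K A (e i)) ∘ₗ C.toLinearMap =
      (Finsupp.linearCombination (Env K A) (id : M → M)).restrictScalars K := by
    rw [← LinearEquiv.eq_comp_toLinearMap_symm]
    ext ⟨n, k⟩ a
    have h : C.symm (Finsupp.single (n, k) a) =
        Finsupp.single n (Env.tmul K (b k) (MulOpposite.op a)) := by
      rw [← hEs]
      simp [C, Finsupp.curryLinearEquiv]
    simp [h, e, ract_apply, ← mul_smul, Env.tmul_mul_tmul]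
  refine ⟨_, e, C.toLinearMap ∘ₗ s.restrictScalars K, ?_, ?_⟩
  · rintro a n ⟨n', k⟩
    simp [hC, ract_apply, hE]
  · intro n
    have h := LinearMap.congr_fun hR (s n)
    simp only [LinearMap.comp_apply, LinearMap.restrictScalars_apply, hs n, Finsupp.lsum_apply]
      at h
    exact h

/-- Tensoring over `A` with a projective `Aᵉ`-module on the right preserves injectivity. -/
theorem BTensor.map_id_right_injective [Module.Projective (Env K A) N] (f : M →ₗ[Env K A] M')
    (hf : Function.Injective f) :
    Function.Injective (BTensor.map f (LinearMap.id : N →ₗ[Env K A] N)) := by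
  obtain ⟨κ, e, c, hc, he⟩ := exists_left_dualBasis K A N
  -- Coordinates on the tensor product, `m ⊗ n ↦ (m · cᵢ(n))ᵢ`; balancedness is the left
  -- `A`-linearity of `c`. `Θ'` is the same map for `M'`.
  let Θ : BTensor K A M N →ₗ[K] N × κ →₀ M := BTensor.lift K A
    (LinearMap.mk₂ K (fun m n => Finsupp.mapRange.linearMap (ractOn K A m) (c n))
      (fun _ _ _ => by ext; simp) (fun _ _ _ => by ext; simp)
      (fun _ _ _ => by ext; simp [-ractOn_apply]) (fun _ _ _ => by ext; simp [-ractOn_apply]))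
    (fun a m n => by ext i; simp [hc, ract_apply, ← mul_smul, Env.tmul_mul_tmul])
  let Θ' : BTensor K A M' N →ₗ[K] N × κ →₀ M' := BTensor.lift K A
    (LinearMap.mk₂ K (fun m n => Finsupp.mapRange.linearMap (ractOn K A m) (c n))
      (fun _ _ _ => by ext; simp) (fun _ _ _ => by ext; simp)
      (fun _ _ _ => by ext; simp [-ractOn_apply]) (fun _ _ _ => by ext; simp [-ractOn_apply]))
    (fun a m n => by ext i; simp [hc, ract_apply, ← mul_smul, Env.tmul_mul_tmul])
  -- The dual basis identity makes `(mᵢ) ↦ ∑ mᵢ ⊗ eᵢ` a left inverse of `Θ`, so `Θ` is injective. By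
  -- naturality, `f ⊗ id` becomes `f` applied to each coordinate.
  have hΘ : Finsupp.lsum K (fun i => (BTensor.mk K A M N).flip (e i)) ∘ₗ Θ = LinearMap.id := by
    refine BTensor.hom_ext fun m n => ?_
    simp only [LinearMap.comp_apply, Θ, BTensor.lift_tmul, LinearMap.mk₂_apply,
      Finsupp.lsum_apply, Finsupp.mapRange.linearMap_apply, LinearMap.id_apply]
    rw [Finsupp.sum_mapRange_index (by simp)]
    simp only [ractOn_apply, LinearMap.flip_apply, BTensor.ract_tmul]
    conv_rhs => rw [← he n]
    exact (map_finsuppSum (BTensor.mk K A M N m) _ _).symm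
  have hnat : ∀ z i, Θ' (BTensor.map f LinearMap.id z) i = f (Θ z i) := by
    intro z i
    induction z using BTensor.induction with
    | h0 => simp
    | ht m n => simp [Θ, Θ', ract_apply]
    | ha x y hx hy => simp [hx, hy]
  intro x y hxy
  have h : Θ x = Θ y := by
    ext i
    apply hf
    rw [← hnat, ← hnat, hxy]
  have hx := LinearMap.congr_fun hΘ x
  rw [LinearMap.comp_apply, h, ← LinearMap.comp_apply, hΘ] at hx
  exact hx.symm

/-- Tensoring over `A` with a projective `Aᵉ`-module on the left preserves injectivity. -/
theorem BTensor.map_id_left_injective [Module.Projective (Env K A) M] (g : N →ₗ[Env K A] N')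
    (hg : Function.Injective g) :
    Function.Injective (BTensor.map (LinearMap.id : M →ₗ[Env K A] M) g) := by
  obtain ⟨κ, e, c, hc, he⟩ := exists_right_dualBasis K A M
  let Θ : BTensor K A M N →ₗ[K] M × κ →₀ N := BTensor.lift K A
    (LinearMap.mk₂ K (fun m n => Finsupp.mapRange.linearMap (lactOn K A n) (c m))
      (fun _ _ _ => by ext; simp [-lactOn_apply]) (fun _ _ _ => by ext; simp [-lactOn_apply])
      (fun _ _ _ => by ext; simp) (fun _ _ _ => by ext; simp))
    (fun a m n => by ext i; simp [hc, lact_apply, ← mul_smul, Env.tmul_mul_tmul])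
  let Θ' : BTensor K A M N' →ₗ[K] M × κ →₀ N' := BTensor.lift K A
    (LinearMap.mk₂ K (fun m n => Finsupp.mapRange.linearMap (lactOn K A n) (c m))
      (fun _ _ _ => by ext; simp [-lactOn_apply]) (fun _ _ _ => by ext; simp [-lactOn_apply])
      (fun _ _ _ => by ext; simp) (fun _ _ _ => by ext; simp))
    (fun a m n => by ext i; simp [hc, lact_apply, ← mul_smul, Env.tmul_mul_tmul])
  have hΘ : Finsupp.lsum K (fun i => BTensor.mk K A M N (e i)) ∘ₗ Θ = LinearMap.id := by
    refine BTensor.hom_ext fun m n => ?_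
    simp only [LinearMap.comp_apply, Θ, BTensor.lift_tmul, LinearMap.mk₂_apply,
      Finsupp.lsum_apply, Finsupp.mapRange.linearMap_apply, LinearMap.id_apply]
    rw [Finsupp.sum_mapRange_index (by simp)]
    simp only [lactOn_apply, ← BTensor.ract_tmul]
    conv_rhs => rw [← he m]
    exact (map_finsuppSum ((BTensor.mk K A M N).flip n) _ _).symm
  have hnat : ∀ z i, Θ' (BTensor.map LinearMap.id g z) i = g (Θ z i) := by
    intro z i
    induction z using BTensor.induction with
    | h0 => simp
    | ht m n => simp [Θ, Θ', lact_apply]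
    | ha x y hx hy => simp [hx, hy]
  intro x y hxy
  have h : Θ x = Θ y := by
    ext i
    apply hg
    rw [← hnat, ← hnat, hxy]
  have hx := LinearMap.congr_fun hΘ x
  rw [LinearMap.comp_apply, h, ← LinearMap.comp_apply, hΘ] at hx
  exact hx.symm

/-- Factoring `f ⊗ g` as `(id ⊗ g) ∘ (f ⊗ id)` passes through `M' ⊗_A N`, so projectivity is needed
only for the source of `g` and the target of `f`. -/
theorem BTensor.map_injective [Module.Projective (Env K A) N] [Module.Projective (Env K A) M']
    {f : M →ₗ[Env K A] M'} (hf : Function.Injective f) {g : N →ₗ[Env K A] N'}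
    (hg : Function.Injective g) : Function.Injective (BTensor.map f g) := by
  have h : ∀ z, BTensor.map f g z =
      BTensor.map LinearMap.id g (BTensor.map f LinearMap.id z) := by
    intro z
    induction z using BTensor.induction with
    | h0 => simp
    | ht m n => simp only [BTensor.map_tmul, LinearMap.id_apply]
    | ha x y hx hy => simp only [map_add, hx, hy]
  intro x y hxy
  rw [h, h] at hxy
  exact BTensor.map_id_right_injective f hf (BTensor.map_id_left_injective g hg hxy)

end DualBasis

/-! ### Filtered maps and their associated graded maps. -/

section GrMap

variable {K : Type u} {A : Type v} [Field K] [Ring A] [Algebra K A]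
variable {M N : Type*}
  [AddCommGroup M] [Module K M] [Module (Env K A) M] [IsScalarTower K (Env K A) M]
  [AddCommGroup N] [Module K N] [Module (Env K A) N] [IsScalarTower K (Env K A) N]
  {F : ℕ → Submodule (Env K A) M} {G : ℕ → Submodule (Env K A) N}

theorem map_mem_prev {f : M →ₗ[Env K A] N} (hf : ∀ n, ∀ x ∈ F n, f x ∈ G n) (n : ℕ) {x : M}
    (hx : x ∈ prev F n) : f x ∈ prev G n := by
  cases n with
  | zero =>
    have : x = 0 := hx
    rw [this, map_zero]
    exact zero_mem _
  | succ n => exact hf n x hx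

/-- The map `gr_n(M) → gr_n(N)` induced by a filtered bimodule map. -/
def grMap (f : M →ₗ[Env K A] N) (hf : ∀ n, ∀ x ∈ F n, f x ∈ G n) (n : ℕ) :
    Gr F n →ₗ[Env K A] Gr G n :=
  Submodule.mapQ _ _ (f.restrict (hf n)) fun _ hx => map_mem_prev hf n hx

theorem grMap_mk (f : M →ₗ[Env K A] N) (hf : ∀ n, ∀ x ∈ F n, f x ∈ G n) (n : ℕ) (x : F n) :
    grMap f hf n (Gr.mk F n x) = Gr.mk G n ⟨f x, hf n x x.2⟩ := rfl

theorem map_mem_tensorFil {f : M →ₗ[Env K A] N} (hf : ∀ n, ∀ x ∈ F n, f x ∈ G n) (n : ℕ) :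
    ∀ z ∈ tensorFil F F n, BTensor.map f f z ∈ tensorFil G G n := by
  intro z hz
  have h : tensorFil F F n ≤ (tensorFil G G n).comap (BTensor.map f f) := by
    refine Submodule.span_le.2 ?_
    rintro _ ⟨i, j, hij, x, hx, y, hy, rfl⟩
    change BTensor.map f f (BTensor.tmul K A x y) ∈ tensorFil G G n
    rw [BTensor.map_tmul]
    exact tmul_mem_tensorFil G G hij (hf i x hx) (hf j y hy)
  exact h hz

/-- The canonical map `gr(M) ⊗_A gr(M) → gr(M ⊗_A M)` is natural for filtered maps. -/
theorem grTensor_lmap (f : M →ₗ[Env K A] N) (hf : ∀ n, ∀ x ∈ F n, f x ∈ G n) (n : ℕ)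
    (w : ⨁ p : Finset.HasAntidiagonal.antidiagonal n, BTensor K A (Gr F p.1.1) (Gr F p.1.2)) :
    grTensor G G n (DirectSum.lmap (fun p : Finset.HasAntidiagonal.antidiagonal n =>
      (BTensor.map (grMap f hf p.1.1) (grMap f hf p.1.2)).restrictScalars K) w) =
    grMap (BTensor.map f f) (map_mem_tensorFil hf) n (grTensor F F n w) := by
  let T := (grMap (BTensor.map f f) (map_mem_tensorFil hf) n).restrictScalars K
  change (grTensor G G n ∘ₗ DirectSum.lmap _) w = (T ∘ₗ grTensor F F n) w
  congr 1
  -- On a generator `[x] ⊗ [y]` both sides are the class of `f x ⊗ f y`.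
  refine DirectSum.linearMap_ext K fun p => BTensor.hom_ext fun x y => ?_
  obtain ⟨x, rfl⟩ := Gr.mk_surjective x
  obtain ⟨y, rfl⟩ := Gr.mk_surjective y
  simp only [LinearMap.comp_apply, DirectSum.lmap_lof, grTensor_of, grTensorComp_tmul,
    LinearMap.restrictScalars_apply, BTensor.map_tmul, grMap_mk]
  refine congrArg _ (Subtype.ext ?_)
  exact (BTensor.map_tmul f f (x : M) (y : M)).symm

variable {D : Coring K A M} {D' : Coring K A N}

theorem grTensor_grComul (h : IsGradedProjectiveFiltered D F) (n : ℕ) (z : Gr F n) :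
    grTensor F F n (h.grComul n z) = h.grMapComul n z :=
  (h.grTensorEquiv n).apply_symm_apply _

/-- A filtered coring map that annihilates a class in `gr_n` annihilates its image under the
comultiplication of the associated graded coring. -/
theorem lmap_grComul_eq_zero (h : IsGradedProjectiveFiltered D F)
    (h' : IsGradedProjectiveFiltered D' G) (f : M →ₗ[Env K A] N)
    (hf : ∀ n, ∀ x ∈ F n, f x ∈ G n)
    (hcomul : ∀ x, BTensor.map f f (D.comul x) = D'.comul (f x)) (n : ℕ) {z : Gr F n}
    (hz : grMap f hf n z = 0) :
    DirectSum.lmap (fun p : Finset.HasAntidiagonal.antidiagonal n =>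
      (BTensor.map (grMap f hf p.1.1) (grMap f hf p.1.2)).restrictScalars K)
      (h.grComul n z) = 0 := by
  -- The canonical isomorphism of the target moves the question to `gr_n(N ⊗_A N)`, where naturality
  -- turns the element into the class of `(f ⊗ f)(Δ x)`, with `x` representing `z`.
  refine (injective_iff_map_eq_zero _).1 (h'.grTensorEquiv n).injective _ ?_
  refine (grTensor_lmap f hf n _).trans ?_
  rw [grTensor_grComul]
  obtain ⟨x, rfl⟩ := Gr.mk_surjective z
  refine Gr.mk_eq_zero.2 ?_
  change BTensor.map f f (D.comul x) ∈ prev (tensorFil G G) n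
  -- The element is now `Δ'(f x)`. Since `f x` lies one step lower in the filtration and `Δ'` is
  -- filtered, its class vanishes.
  rw [hcomul]
  exact h'.comul_mem_prev _ _ (Gr.mk_eq_zero.1 hz)

/-- A filtered coring map that annihilates a class in `gr_{i+j}` annihilates its image under
`Δ^{[i,j]}`. -/
theorem map_grComulComp_eq_zero (h : IsGradedProjectiveFiltered D F)
    (h' : IsGradedProjectiveFiltered D' G) (f : M →ₗ[Env K A] N)
    (hf : ∀ n, ∀ x ∈ F n, f x ∈ G n)
    (hcomul : ∀ x, BTensor.map f f (D.comul x) = D'.comul (f x)) (i j : ℕ) {z : Gr F (i + j)}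
    (hz : grMap f hf (i + j) z = 0) :
    BTensor.map (grMap f hf i) (grMap f hf j) (h.grComulComp i j z) = 0 := by
  let p : Finset.HasAntidiagonal.antidiagonal (i + j) :=
    ⟨(i, j), Finset.HasAntidiagonal.mem_antidiagonal.2 rfl⟩
  -- The direct sum map acts summand by summand, so its `(i, j)` component can be read off.
  have h1 := congrArg (fun w => w p) (lmap_grComul_eq_zero h h' f hf hcomul (i + j) hz)
  simp only [DirectSum.lmap_apply] at h1
  exact h1

/-- A filtered map that is injective on the associated graded modules is injective. -/
theorem injective_of_grMap_injective (f : M →ₗ[Env K A] N) (hf : ∀ n, ∀ x ∈ F n, f x ∈ G n)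
    (hex : ∀ x, ∃ n, x ∈ F n) (hinj : ∀ n, Function.Injective (grMap f hf n)) :
    Function.Injective f := by
  have key : ∀ n, ∀ x ∈ F n, f x = 0 → x = 0 := by
    intro n
    induction n with
    | zero =>
      intro x hx h0
      have h1 : Gr.mk F 0 ⟨x, hx⟩ = 0 := hinj 0 (by
        rw [map_zero, grMap_mk, Gr.mk_eq_zero]
        change f x ∈ _
        rw [h0]
        exact zero_mem _)
      -- `prev F 0` is `⊥`, so a zero class in degree `0` is a zero element.
      exact Gr.mk_eq_zero.1 h1
    | succ n ih =>
      intro x hx h0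
      have h1 : Gr.mk F (n + 1) ⟨x, hx⟩ = 0 := hinj (n + 1) (by
        rw [map_zero, grMap_mk, Gr.mk_eq_zero]
        change f x ∈ _
        rw [h0]
        exact zero_mem _)
      exact ih x (Gr.mk_eq_zero.1 h1) h0
  refine (injective_iff_map_eq_zero f).2 fun x h0 => ?_
  obtain ⟨n, hn⟩ := hex x
  exact key n x hn h0

end GrMap

/-! ### Primitive elements, the counit, and the filtration in degrees 0 and 1. -/

namespace LeftBialgebroid

variable {K : Type u} {A : Type v} [Field K] [Ring A] [Algebra K A]
variable (B : LeftBialgebroid.{u, v, w} K A)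

theorem counit_s (a : A) : B.coring.counit (B.total.s a) = a := by
  have h : B.total.s a = Env.tmul K a (MulOpposite.op 1) • (1 : B) := by
    rw [EnvRing.smul_def, mul_one, MulOpposite.op_one]; rfl
  rw [h, map_smul, B.counit_one, tmul_smul_regular, mul_one, mul_one]

/-- Write `η(a ⊗ b)` as `(a ⊗ b) • 1`: by bimodule linearity of `Δ`, `a` acts on the left leg of `1
⊗ 1` and `b` on the right leg. -/
theorem comul_eta_tmul (a b : A) :
    B.coring.comul (B.total.eta (Env.tmul K a (MulOpposite.op b))) =
      BTensor.tmul K A (B.total.s a) (B.total.t (MulOpposite.op b)) := by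
  have h : B.total.eta (Env.tmul K a (MulOpposite.op b)) =
      Env.tmul K a (MulOpposite.op b) • (1 : B) := by
    rw [EnvRing.smul_def, mul_one]
  rw [h, map_smul, B.comul_one, BTensor.env_smul_tmul, ← EnvRing.s_mul, ← EnvRing.t_mul, mul_one,
    mul_one]

theorem comul_s (a : A) :
    B.coring.comul (B.total.s a) = BTensor.tmul K A (B.total.s a) 1 := by
  have h := B.comul_eta_tmul a 1
  rwa [MulOpposite.op_one, map_one] at h

theorem comul_t (a : A) : B.coring.comul (B.total.t (MulOpposite.op a)) =
    BTensor.tmul K A 1 (B.total.t (MulOpposite.op a)) := by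
  have h := B.comul_eta_tmul 1 a
  rwa [map_one] at h

/-- The left counit axiom collapses `x ⊗ 1` to `ε(x) · 1`. With `eq_t_of_comul`, this is how
commutators with primitives are recognised as elements of `η(Aᵉ)`. -/
theorem eq_s_of_comul {x : B} (h : B.coring.comul x = BTensor.tmul K A x 1) :
    x = B.total.s (B.coring.counit x) := by
  have h1 := B.coring.counit_left x
  rw [h, BTensor.map_tmul, BTensor.lUnit_tmul, ← EnvRing.s_mul, LinearMap.id_apply, mul_one] at h1
  exact h1.symm

theorem eq_t_of_comul {x : B} (h : B.coring.comul x = BTensor.tmul K A 1 x) :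
    x = B.total.t (MulOpposite.op (B.coring.counit x)) := by
  have h1 := B.coring.counit_right x
  rw [h, BTensor.map_tmul, BTensor.rUnit_tmul, ← EnvRing.t_mul, LinearMap.id_apply, mul_one] at h1
  exact h1.symm

variable {B}

/-- The left counit axiom reads `s(ε(X)) + X = X`, and `s` is injective because `ε` splits it. -/
theorem counit_prim {X : B} (hX : X ∈ B.prim) : B.coring.counit X = 0 := by
  have h1 := B.coring.counit_left X
  have hX' : B.coring.comul X = _ := hX
  rw [hX', map_add, map_add, BTensor.map_tmul, BTensor.map_tmul, BTensor.lUnit_tmul,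
    BTensor.lUnit_tmul, B.counit_one, ← EnvRing.s_mul, ← EnvRing.s_mul,
    map_one B.total.s, LinearMap.id_apply, LinearMap.id_apply, mul_one, one_mul, add_eq_right] at h1
  rw [← B.counit_s (B.coring.counit X), h1, map_zero]

/-- In `Δ(X s(a)) - Δ(s(a) X)` the terms `s(a) ⊗ X` cancel. The commutator `c` therefore satisfies
`Δ(c) = c ⊗ 1`, which forces it into the image of `s`. -/
theorem prim_mul_s {X : B} (hX : X ∈ B.prim) (a : A) :
    ∃ y, X * B.total.s a = B.total.s a * X + B.total.eta y := by
  have hX' : B.coring.comul X = _ := hX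
  have h : B.coring.comul (X * B.total.s a - B.total.s a * X) =
      BTensor.tmul K A (X * B.total.s a - B.total.s a * X) 1 := by
    rw [map_sub, B.comul_mul, B.comul_s, EnvRing.takMul_tmul, EnvRing.s_mul, lact_apply, map_smul,
      ← lact_apply]
    simp only [hX', map_add, EnvRing.rmul_tmul, BTensor.lact_tmul, ← EnvRing.s_mul, mul_one,
      one_mul, BTensor.tmul, map_sub, LinearMap.sub_apply]
    abel
  refine ⟨_, sub_eq_iff_eq_add'.1 (B.eq_s_of_comul h)⟩

/-- Mirror image of `prim_mul_s`: the terms `X ⊗ t(a)` cancel, and the commutator lands in the image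
of `t`. -/
theorem prim_mul_t {X : B} (hX : X ∈ B.prim) (a : A) :
    ∃ y, X * B.total.t (MulOpposite.op a) = B.total.t (MulOpposite.op a) * X + B.total.eta y := by
  have hX' : B.coring.comul X = _ := hX
  have h : B.coring.comul
      (X * B.total.t (MulOpposite.op a) - B.total.t (MulOpposite.op a) * X) =
      BTensor.tmul K A 1
        (X * B.total.t (MulOpposite.op a) - B.total.t (MulOpposite.op a) * X) := by
    rw [map_sub, B.comul_mul, B.comul_t, EnvRing.takMul_tmul, EnvRing.t_mul, ract_apply, map_smul,
      ← ract_apply]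
    simp only [hX', map_add, EnvRing.rmul_tmul, BTensor.ract_tmul_right, ← EnvRing.t_mul, mul_one,
      one_mul, BTensor.tmul, map_sub]
    abel
  refine ⟨_, sub_eq_iff_eq_add'.1 (B.eq_t_of_comul h)⟩

theorem prim_mul_eta {X : B} (hX : X ∈ B.prim) (x : Env K A) :
    ∃ y, X * B.total.eta x = B.total.eta x * X + B.total.eta y := by
  induction x using Env.induction with
  | h0 => exact ⟨0, by simp⟩
  | ht a b =>
    obtain ⟨b, rfl⟩ := MulOpposite.op_surjective b
    obtain ⟨y, hy⟩ := prim_mul_s hX a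
    obtain ⟨z, hz⟩ := prim_mul_t hX b
    -- Move `X` past `s(a)`, leaving `η(y) t(b)`, then past `t(b)`, leaving `s(a) η(z)`.
    refine ⟨Env.tmul K a 1 * z + y * Env.tmul K 1 (MulOpposite.op b), ?_⟩
    have hs : B.total.eta (Env.tmul K a 1) = B.total.s a := rfl
    have ht : B.total.eta (Env.tmul K 1 (MulOpposite.op b)) = B.total.t (MulOpposite.op b) := rfl
    rw [EnvRing.eta_tmul, ← mul_assoc, hy, add_mul, mul_assoc, hz, map_add, map_mul, map_mul, hs,
      ht, mul_add, mul_assoc, add_assoc]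
  | ha x y hx hy =>
    obtain ⟨x', hx⟩ := hx
    obtain ⟨y', hy⟩ := hy
    refine ⟨x' + y', ?_⟩
    simp only [map_add, mul_add, add_mul, hx, hy]
    abel

/-- Balancing over `A` gives `t(a) ⊗ 1 = 1 ⊗ s(a)`, so the two mixed terms required for primitivity
cancel. -/
theorem s_sub_t_mem_prim (a : A) : B.total.s a - B.total.t (MulOpposite.op a) ∈ B.prim := by
  have h : BTensor.tmul K A (B.total.t (MulOpposite.op a)) (1 : B) =
      BTensor.tmul K A 1 (B.total.s a) := by
    have := BTensor.ract_tmul K A a (1 : B) (1 : B)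
    rwa [← EnvRing.t_mul, ← EnvRing.s_mul, mul_one, mul_one] at this
  rw [mem_prim, map_sub, B.comul_s, B.comul_t]
  simp only [BTensor.tmul, map_sub, LinearMap.sub_apply] at h ⊢
  rw [h]
  abel

variable (B) in
/-- The left `Aᵉ`-submodule generated by the primitive elements. -/
abbrev primSpan : Submodule (Env K A) B := Submodule.span (Env K A) (B.prim : Set B)

/-- As `x • 1 = ε(η(x))`, this puts every `η(x)` of counit zero in `Aᵉ · Prim(B)`. On pure tensors,
`s(a) t(b) - s(a b) = -s(a) (s(b) - t(b))`. -/
theorem eta_sub_s_mem_primSpan (x : Env K A) :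
    B.total.eta x - B.total.s (x • (1 : A)) ∈ B.primSpan := by
  induction x using Env.induction with
  | h0 => simp
  | ht a b =>
    obtain ⟨b, rfl⟩ := MulOpposite.op_surjective b
    have h : B.total.eta (Env.tmul K a (MulOpposite.op b)) -
        B.total.s (Env.tmul K a (MulOpposite.op b) • (1 : A)) =
        -(Env.tmul K a 1 • (B.total.s b - B.total.t (MulOpposite.op b))) := by
      rw [tmul_smul_regular, mul_one, EnvRing.eta_tmul, EnvRing.smul_def,
        show B.total.eta (Env.tmul K a 1) = B.total.s a from rfl, map_mul, mul_sub, neg_sub]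
    rw [h]
    exact neg_mem (Submodule.smul_mem _ _ (Submodule.subset_span (s_sub_t_mem_prim b)))
  | ha x y hx hy =>
    have h := add_mem hx hy
    rw [map_add, add_smul, map_add, add_sub_add_comm]
    exact h

theorem counit_primSpan {z : B} (hz : z ∈ B.primSpan) : B.coring.counit z = 0 := by
  have h : B.primSpan ≤ LinearMap.ker B.coring.counit :=
    Submodule.span_le.2 fun X hX => counit_prim hX
  exact h hz

theorem eta_mem_primFil (x : Env K A) (n : ℕ) : B.total.eta x ∈ B.primFil n :=
  B.tensorImage_le_primFil (Nat.zero_le n) ⟨x, rfl⟩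

theorem mem_primFil_zero {z : B} (hz : z ∈ B.primFil 0) : ∃ x, B.total.eta x = z := by
  have h : B.primFil 0 ≤ B.tensorImage 0 := iSup_le fun k => by
    rw [show (k : ℕ) = 0 by omega]
  exact h hz

/-- Coefficients to the right of a primitive move to its left at the cost of an element of `η(Aᵉ)`,
by `prim_mul_eta`. Two-sided spans of primitives thus reduce to left ones. -/
theorem mul_eta_mem_eta_add_primSpan {z : B} (hz : z ∈ B.primImage) (y : Env K A) :
    ∃ x, z * B.total.eta y - B.total.eta x ∈ B.primSpan := by
  refine Submodule.span_induction ?_ ?_ ?_ ?_ hz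
  · rintro _ ⟨a, X, b, hX, rfl⟩
    obtain ⟨c, hc⟩ := prim_mul_eta hX (b * y)
    refine ⟨a * c, ?_⟩
    have h : B.total.eta a * X * B.total.eta b * B.total.eta y - B.total.eta (a * c) =
        (a * (b * y)) • X := by
      rw [mul_assoc, ← map_mul, mul_assoc, hc, mul_add, ← mul_assoc, ← map_mul, ← map_mul,
        add_sub_cancel_right, EnvRing.smul_def]
    rw [h]
    exact Submodule.smul_mem _ _ (Submodule.subset_span hX)
  · exact ⟨0, by simp⟩
  · rintro u v _ _ ⟨x, hx⟩ ⟨x', hx'⟩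
    refine ⟨x + x', ?_⟩
    have h := add_mem hx hx'
    rw [add_mul, map_add, add_sub_add_comm]
    exact h
  · rintro k u _ ⟨x, hx⟩
    refine ⟨k • x, ?_⟩
    have h := (B.primSpan.restrictScalars K).smul_mem k hx
    rwa [smul_sub, ← smul_mul_assoc, ← map_smul] at h

theorem mem_primFil_one {z : B} (hz : z ∈ B.primFil 1) :
    ∃ x, z - B.total.eta x ∈ B.primSpan := by
  -- `S` is `η(Aᵉ)`, viewed as the left submodule generated by `1`.
  let S : Submodule (Env K A) B := LinearMap.range (LinearMap.toSpanSingleton (Env K A) B 1)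
  have hη : ∀ x, B.total.eta x ∈ S := fun x => ⟨x, by
    rw [LinearMap.toSpanSingleton_apply, EnvRing.smul_def, mul_one]⟩
  have h : B.primFil 1 ≤ S ⊔ B.primSpan := by
    refine iSup_le fun k => ?_
    rcases (show (k : ℕ) = 0 ∨ (k : ℕ) = 1 by omega) with hk | hk
    · rw [hk]
      rintro _ ⟨x, rfl⟩
      exact Submodule.mem_sup_left (hη x)
    · rw [hk]
      intro z hz
      change z ∈ B.primImage * B.tensorImageAux 0 at hz
      refine Submodule.mul_induction_on hz ?_ fun u v hu hv => add_mem hu hv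
      rintro u hu _ ⟨y, rfl⟩
      obtain ⟨x, hx⟩ := mul_eta_mem_eta_add_primSpan hu y
      have := add_mem (Submodule.mem_sup_left (hη x)) (Submodule.mem_sup_right hx)
      rwa [add_sub_cancel] at this
  obtain ⟨_, ⟨x, rfl⟩, p, hp, rfl⟩ := Submodule.mem_sup.1 (h hz)
  refine ⟨x, ?_⟩
  rwa [LinearMap.toSpanSingleton_apply, EnvRing.smul_def, mul_one, add_sub_cancel_left]

/-! ### Morphisms respect the primitive filtration and are controlled on its first step. -/

namespace Hom

variable {B' : LeftBialgebroid.{u, v, w'} K A} (φ : Hom B B')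

theorem map_prim {X : B} (hX : X ∈ B.prim) : φ X ∈ B'.prim := by
  have hX' : B.coring.comul X = _ := hX
  have h := φ.comul_comp X
  rw [hX', map_add, BTensor.map_tmul, BTensor.map_tmul] at h
  have h1 : φ.toHom.toBimoduleMap 1 = 1 := map_one φ.toAlgHom
  rw [h1] at h
  exact h.symm

theorem map_primImage : B.primImage.map φ.toAlgHom.toLinearMap ≤ B'.primImage := by
  rw [primImage, Submodule.map_span, Submodule.span_le]
  rintro _ ⟨_, ⟨x, X, y, hX, rfl⟩, rfl⟩
  refine Submodule.subset_span ⟨x, φ X, y, φ.map_prim hX, ?_⟩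
  rw [AlgHom.toLinearMap_apply, map_mul, map_mul, φ.map_eta, φ.map_eta]

theorem map_tensorImageAux (k : ℕ) :
    (B.tensorImageAux k).map φ.toAlgHom.toLinearMap ≤ B'.tensorImageAux k := by
  induction k with
  | zero =>
    rintro _ ⟨_, ⟨x, rfl⟩, rfl⟩
    exact ⟨x, (φ.map_eta x).symm⟩
  | succ k ih =>
    rw [tensorImageAux, Submodule.map_mul]
    exact mul_le_mul' φ.map_primImage ih

theorem map_primFil (n : ℕ) : ∀ x ∈ B.primFil n, φ.toHom.toBimoduleMap x ∈ B'.primFil n := by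
  intro x hx
  have h : B.primFil n ≤ (B'.primFil n).comap φ.toHom.toBimoduleMap :=
    iSup_le fun k z hz => B'.tensorImage_le_primFil (Nat.le_of_lt_succ k.2)
      (φ.map_tensorImageAux k ⟨z, hz, rfl⟩)
  exact h hx

/-- A morphism that is injective on `Aᵉ · Prim(B)` is injective on `F_1(B)`. -/
theorem eq_zero_of_mem_primFil_one (hφ : Set.InjOn φ (B.primSpan : Set B)) {z : B}
    (hz : z ∈ B.primFil 1) (h0 : φ z = 0) : z = 0 := by
  obtain ⟨x, hx⟩ := mem_primFil_one hz
  -- Morphisms preserve the counit, so it vanishes on the kernel of `φ`. It also vanishes on `Aᵉ ·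
  -- Prim(B)`, hence on the remaining part `η(x)` of `z`.
  have hεz : B.coring.counit z = 0 := by
    have h := φ.counit_comp z
    rw [show φ.toHom.toBimoduleMap z = 0 from h0, map_zero] at h
    exact h.symm
  have hεx : x • (1 : A) = 0 := by
    have h := counit_primSpan hx
    have h' : B.total.eta x = x • (1 : B) := by rw [EnvRing.smul_def, mul_one]
    rwa [map_sub, hεz, zero_sub, neg_eq_zero, h', map_smul, B.counit_one] at h
  -- `η(x)` has counit zero, so it is itself in `Aᵉ · Prim(B)`. All of `z` is then in the region
  -- where `φ` is assumed injective.
  have hηx : B.total.eta x ∈ B.primSpan := by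
    have h := eta_sub_s_mem_primSpan (B := B) x
    rwa [hεx, map_zero, sub_zero] at h
  have hmem : z ∈ B.primSpan := by
    have h := add_mem hx hηx
    rwa [sub_add_cancel] at h
  exact hφ hmem (zero_mem _) (h0.trans (map_zero φ.toAlgHom).symm)

end Hom

end LeftBialgebroid

/-! ### Injectivity on the associated graded modules, by induction on the degree. -/

namespace LeftBialgebroid.Hom

variable {K : Type u} {A : Type v} [Field K] [Ring A] [Algebra K A]
variable {B : LeftBialgebroid.{u, v, w} K A} {B' : LeftBialgebroid.{u, v, w'} K A} (φ : Hom B B')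

theorem grMap_zero_injective (hφ : Set.InjOn φ (B.primSpan : Set B)) :
    Function.Injective (grMap φ.toHom.toBimoduleMap φ.map_primFil 0) := by
  refine (injective_iff_map_eq_zero _).2 fun z hz => ?_
  obtain ⟨x, rfl⟩ := Gr.mk_surjective z
  have h0 : φ (x : B) = 0 := Gr.mk_eq_zero.1 hz
  exact Gr.mk_eq_zero.2
    (φ.eq_zero_of_mem_primFil_one hφ (B.primFil_mono zero_le_one x.2) h0)

theorem grMap_one_injective (hφ : Set.InjOn φ (B.primSpan : Set B)) :
    Function.Injective (grMap φ.toHom.toBimoduleMap φ.map_primFil 1) := by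
  refine (injective_iff_map_eq_zero _).2 fun z hz => ?_
  obtain ⟨x, rfl⟩ := Gr.mk_surjective z
  have h0 : φ (x : B) ∈ B'.primFil 0 := Gr.mk_eq_zero.1 hz
  obtain ⟨y, hy⟩ := mem_primFil_zero h0
  -- If `φ x` drops to `F_0(B') = η'(Aᵉ)`, it is the image of some `η(y)`. Injectivity on `F_1` then
  -- gives `x = η(y)`, which lies in `F_0`.
  have h1 : φ ((x : B) - B.total.eta y) = 0 := by
    rw [map_sub, φ.map_eta, hy, sub_self]
  have h2 := φ.eq_zero_of_mem_primFil_one hφ (sub_mem x.2 (eta_mem_primFil y 1)) h1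
  refine Gr.mk_eq_zero.2 ?_
  change (x : B) ∈ B.primFil 0
  rw [sub_eq_zero.1 h2]
  exact eta_mem_primFil y 0

/-- If `gr(B)` is strongly graded, a morphism that is injective on `Aᵉ · Prim(B)` is injective on
the associated graded modules of the primitive filtrations. -/
theorem grMap_injective (hgen : B.IsPrimitivelyGenerated) (hproj : B.IsGradedProjective)
    (hgen' : B'.IsPrimitivelyGenerated) (hproj' : B'.IsGradedProjective)
    (hstrong : (isGradedProjectiveFiltered hgen hproj).GrStronglyGraded)
    (hφ : Set.InjOn φ (B.primSpan : Set B)) (n : ℕ) :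
    Function.Injective (grMap φ.toHom.toBimoduleMap φ.map_primFil n) := by
  induction n with
  | zero => exact φ.grMap_zero_injective hφ
  | succ n ih =>
    -- The projectivity needed for `gr_n(φ) ⊗ gr_1(φ)` is that of `gr_1(B)` and `gr_n(B')`.
    have := hproj 1
    have := hproj' n
    refine (injective_iff_map_eq_zero _).2 fun z hz => ?_
    have h0 := map_grComulComp_eq_zero (isGradedProjectiveFiltered hgen hproj)
      (isGradedProjectiveFiltered hgen' hproj') φ.toHom.toBimoduleMap φ.map_primFil φ.comul_comp
      n 1 hz
    have h1 := BTensor.map_injective ih (φ.grMap_one_injective hφ) (h0.trans (map_zero _).symm)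
    -- Only the components `Δ^{[n,1]}` of the strong grading enter. For `n = 0` this recovers degree
    -- `1`, whose injectivity was already supplied by `grMap_one_injective`.
    exact hstrong n 1 (h1.trans (map_zero _).symm)

end LeftBialgebroid.Hom

end Bialgd

end

theorem mainTheorem5 {K : Type*} [Field K] [CharZero K] {A : Type*} [Ring A] [Algebra K A]
    (B : Bialgd.LeftBialgebroid K A) (B' : Bialgd.LeftBialgebroid K A)
    (hgen : B.IsPrimitivelyGenerated) (hproj : B.IsGradedProjective)
    (hgen' : B'.IsPrimitivelyGenerated) (hproj' : B'.IsGradedProjective)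
    (hstrong : (Bialgd.LeftBialgebroid.isGradedProjectiveFiltered hgen hproj).GrStronglyGraded)
    (φ : Bialgd.LeftBialgebroid.Hom B B')
    (hφ : Set.InjOn φ (Submodule.span (Bialgd.Env K A) (B.prim : Set B) : Set B)) :
    Function.Injective φ :=
  Bialgd.injective_of_grMap_injective φ.toHom.toBimoduleMap φ.map_primFil hgen
    (φ.grMap_injective hgen hproj hgen' hproj' hstrong hφ)
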